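/- Let $F$ be a field; vector spaces, linear maps, tensor products, (co)algebras and bialgebras are over $F$, algebras being unital associative and coalgebras counital coassociative. Let $\Omega$ be a set with maps $s,t\colon\Omega\to\mathbb Z_{\ge 0}$. An $\Omega$-algebra is a vector space $A$ with linear maps $\omega_A\colon A^{\otimes s(\omega)}\to A^{\otimes t(\omega)}$, $\omega\in\Omega$, where $A^{\otimes 0}=F$. Let $\Omega^*$ be $\Omega$ with $s$ and $t$ interchanged; if $A$ is a finite dimensional $\Omega$-algebra, then $A^*$ is an $\Omega^*$-algebra whose operations are the transposes of those of $A$. For a coalgebra $P$ and an $\Omega$-algebra $A$, a linear map $\psi\colon P\otimes A\to A$ is a *measuring* if $\psi_{t(\omega)}(p\otimes\omega_A(x))=\omega_A(\psi_{s(\omega)}(p\otimes x))$ for all $\omega\in\Omega$, $p\in P$, $x\in A^{\otimes s(\omega)}$, where $\psi_n(p\otimes a_1\otimes\dots\otimes a_n)=\psi(p_{(1)}\otimes a_1)\otimes\dots\otimes\psi(p_{(n)}\otimes a_n)$ and $\psi_0=\varepsilon_P$; its *cosupport* is $\{\psi(p\otimes -)\mid p\in P\}\subseteq\mathrm{End}_F(A)$.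 For an algebra $Q$, a linear map $\rho\colon A\to A\otimes Q$, $\rho(a)=a_{(0)}\otimes a_{(1)}$, is a *comeasuring* if $\rho_{t(\omega)}(\omega_A(x))=(\omega_A\otimes\mathrm{id}_Q)\rho_{s(\omega)}(x)$ for all $\omega\in\Omega$, $x\in A^{\otimes s(\omega)}$, where $\rho_n(a_1\otimes\dots\otimes a_n)=(a_1)_{(0)}\otimes\dots\otimes(a_n)_{(0)}\otimes(a_1)_{(1)}\cdots(a_n)_{(1)}$ and $\rho_0(\alpha)=\alpha 1_Q$; its *cosupport* is $\{a\mapsto q^*(a_{(1)})a_{(0)}\mid q^*\in Q^*\}\subseteq\mathrm{End}_F(A)$. For a unital subalgebra $W\subseteq\mathrm{End}_F(A)$, the *$W$-universal acting bialgebra* ${}_\square\mathcal B(A,W)$ is, as a coalgebra, the terminal object among the coalgebras $P$ with a measuring $P\otimes A\to A$ of cosupport contained in $W$ (morphisms are the coalgebra homomorphisms compatible with the measurings), with the multiplication and unit for which the terminal measuring is a unital left module structure on $A$. The *$W$-universal coacting bialgebra* $\mathcal B^\square(A,W)$ is, as an algebra, the initial object among the algebras $Q$ with a comeasuring $A\to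 A\otimes Q$ of cosupport contained in $W$ (morphisms are the unital algebra homomorphisms compatible with the comeasurings), with the comultiplication and counit for which the initial comeasuring is a counital right comodule structure on $A$. **Theorem.** Let $A$ be a finite dimensional $\Omega$-algebra, let $V\subseteq\mathrm{End}_F(A^*)$ be a unital subalgebra, and let $V^\#=\{f^*\mid f\in V\}\subseteq\mathrm{End}_F(A)$, where $A^{**}$ is identified with $A$. Then: 1. the bialgebras ${}_\square\mathcal B(A^*,V)$ and ${}_\square\mathcal B(A,V^\#)$ exist, and there is a bialgebra isomorphism ${}_\square\mathcal B(A^*,V)\cong{}_\square\mathcal B(A,V^\#)^{\mathrm{op}}$; 2. the bialgebras $\mathcal B^\square(A^*,V)$ and $\mathcal B^\square(A,V^\#)$ exist, and there is a bialgebra isomorphism $\mathcal B^\square(A^*,V)\cong\mathcal B^\square(A,V^\#)^{\mathrm{cop}}$. -/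

import Mathlib

open scoped TensorProduct

universe u w

noncomputable section

/-! ### `Ω`-algebras -/

section OmegaAlgebras

variable {F : Type*} [Field F] {Ω : Type*} {s t : Ω → ℕ}

/-- An `Ω`-algebra structure on the vector space `A`, where `Ω` is a set with source and target
maps `s, t : Ω → ℕ`: a linear map `A^{⊗ s(ω)} → A^{⊗ t(ω)}` for every `ω ∈ Ω`. -/
structure OmegaAlgebra (F : Type*) [Field F] {Ω : Type*} (s t : Ω → ℕ)
    (A : Type*) [AddCommGroup A] [Module F A] where
  op : ∀ ω : Ω, (⨂[F]^(s ω) A) →ₗ[F] (⨂[F]^(t ω) A)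

/-- The dual `Ω*`-algebra `A*` of a finite dimensional `Ω`-algebra `A`. The set `Ω*` is `Ω` with
source and target interchanged; the operations are the transposes of those of `A`, under the
canonical identification `(A*)^{⊗ n} ≅ (A^{⊗ n})*`,
`(f₁ ⊗ ⋯ ⊗ fₙ)(a₁ ⊗ ⋯ ⊗ aₙ) = f₁(a₁) ⋯ fₙ(aₙ)`. -/
def OmegaAlgebra.dual {A : Type*} [AddCommGroup A] [Module F A] [FiniteDimensional F A]
    (𝒜 : OmegaAlgebra F s t A) : OmegaAlgebra F t s (Module.Dual F A) where
  op ω :=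
    (PiTensorProduct.dualDistribEquiv (R := F) (M := fun _ : Fin (s ω) => A)).symm.toLinearMap
      ∘ₗ (𝒜.op ω).dualMap
      ∘ₗ (PiTensorProduct.dualDistribEquiv (R := F) (M := fun _ : Fin (t ω) => A)).toLinearMap

end OmegaAlgebras

/-! ### Measurings and universal measuring coalgebras -/

section Measurings

variable {F : Type*} [Field F] {Ω : Type*} {s t : Ω → ℕ}
variable {A : Type*} [AddCommGroup A] [Module F A] {B : Type*} [AddCommGroup B] [Module F B]

/-- The iterated comultiplication `p ↦ p₍₁₎ ⊗ ⋯ ⊗ p₍ₙ₎`; for `n = 0` it is the counit. -/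
def comulPow (F : Type*) [Field F] (P : Type*) [AddCommGroup P] [Module F P] [Coalgebra F P] :
    (n : ℕ) → P →ₗ[F] ⨂[F]^n P
  | 0 => (TensorPower.algebraMap₀ (R := F) (M := P)).toLinearMap ∘ₗ Coalgebra.counit
  | n + 1 =>
      (TensorPower.mulEquiv (R := F) (M := P) (n := n) (m := 1)).toLinearMap
        ∘ₗ TensorProduct.map (comulPow F P n)
          (PiTensorProduct.subsingletonEquiv (R := F) (s := fun _ => P) (0 : Fin 1)).symm.toLinearMap
        ∘ₗ Coalgebra.comul

variable {P : Type*} [AddCommGroup P] [Module F P] [Coalgebra F P]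

/-- For a linear map `ψ : P ⊗ A → B`, given in the curried form `p ↦ (a ↦ ψ(p ⊗ a))`, the map
`ψₙ(p ⊗ a₁ ⊗ ⋯ ⊗ aₙ) = ψ(p₍₁₎ ⊗ a₁) ⊗ ⋯ ⊗ ψ(p₍ₙ₎ ⊗ aₙ)`, with `ψ₀ = ε`, again curried. -/
def measPow (ψ : P →ₗ[F] A →ₗ[F] B) (n : ℕ) : P →ₗ[F] (⨂[F]^n A) →ₗ[F] (⨂[F]^n B) :=
  PiTensorProduct.piTensorHomMap ∘ₗ PiTensorProduct.map (fun _ : Fin n => ψ) ∘ₗ comulPow F P n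

/-- `ψ : P ⊗ A → B` is a measuring of `Ω`-algebras:
`ψ_{t(ω)}(p ⊗ ω_A(x)) = ω_B(ψ_{s(ω)}(p ⊗ x))`. -/
def IsMeasuring (𝒜 : OmegaAlgebra F s t A) (ℬ : OmegaAlgebra F s t B)
    (ψ : P →ₗ[F] A →ₗ[F] B) : Prop :=
  ∀ (ω : Ω) (p : P) (x : ⨂[F]^(s ω) A),
    measPow ψ (t ω) p (𝒜.op ω x) = ℬ.op ω (measPow ψ (s ω) p x)

end Measurings

/-- `(P, ψ)` is a `V`-universal measuring coalgebra from `A` to `B`: a terminal object in the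
category of the measurings `ψ : P ⊗ A → B` with cosupport contained in `V`. The cosupport of `ψ`
is the set of all the maps `ψ(p ⊗ -)`, that is, the range of the curried map. -/
structure IsUniversalMeasuring {F : Type u} [Field F] {Ω : Type w} {s t : Ω → ℕ}
    {A : Type u} [AddCommGroup A] [Module F A] {B : Type u} [AddCommGroup B] [Module F B]
    (𝒜 : OmegaAlgebra F s t A) (ℬ : OmegaAlgebra F s t B) (V : Submodule F (A →ₗ[F] B))
    {P : Type u} [AddCommGroup P] [Module F P] [Coalgebra F P] (ψ : P →ₗ[F] A →ₗ[F] B) :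
    Prop where
  isMeasuring : IsMeasuring 𝒜 ℬ ψ
  cosupp_le : LinearMap.range ψ ≤ V
  terminal : ∀ {P' : Type u} [AddCommGroup P'] [Module F P'] [Coalgebra F P']
    (ψ' : P' →ₗ[F] A →ₗ[F] B), IsMeasuring 𝒜 ℬ ψ' → LinearMap.range ψ' ≤ V →
      ∃! φ : P' →ₗc[F] P, ψ ∘ₗ φ.toLinearMap = ψ'

/-- `B` acts on the `Ω`-algebra `A` through `ψ : B ⊗ A → A`: this is a unital left `B`-module
structure and a measuring. -/
structure IsAction {F : Type*} [Field F] {Ω : Type*} {s t : Ω → ℕ}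
    {A : Type*} [AddCommGroup A] [Module F A] (𝒜 : OmegaAlgebra F s t A)
    {B : Type*} [Ring B] [Bialgebra F B] (ψ : B →ₗ[F] A →ₗ[F] A) : Prop where
  one_act : ∀ a : A, ψ 1 a = a
  mul_act : ∀ (b b' : B) (a : A), ψ (b * b') a = ψ b (ψ b' a)
  isMeasuring : IsMeasuring 𝒜 𝒜 ψ

/-- The bialgebra `B` with `ψ : B ⊗ A → A` is the `V`-universal acting bialgebra `_□B(A, V)`: as a
coalgebra it is the `V`-universal measuring coalgebra from `A` to `A`, and its multiplication and
unit are those that make `ψ` an action. -/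
structure IsUniversalActing {F : Type u} [Field F] {Ω : Type w} {s t : Ω → ℕ}
    {A : Type u} [AddCommGroup A] [Module F A] (𝒜 : OmegaAlgebra F s t A)
    (V : Subalgebra F (Module.End F A))
    {B : Type u} [Ring B] [Bialgebra F B] (ψ : B →ₗ[F] A →ₗ[F] A) : Prop where
  isUniversalMeasuring : IsUniversalMeasuring 𝒜 𝒜 (Subalgebra.toSubmodule V) ψ
  isAction : IsAction 𝒜 ψ

/-! ### Comeasurings and universal comeasuring algebras -/

section Comeasurings

variable {F : Type*} [Field F] {Ω : Type*} {s t : Ω → ℕ}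
variable {A : Type*} [AddCommGroup A] [Module F A] {B : Type*} [AddCommGroup B] [Module F B]
variable {Q : Type*} [Ring Q] [Algebra F Q]

/-- For a linear map `ρ : A → B ⊗ Q`, `ρ(a) = a₍₀₎ ⊗ a₍₁₎`, the map `ρₙ : A^{⊗ n} → B^{⊗ n} ⊗ Q`,
`ρₙ(a₁ ⊗ ⋯ ⊗ aₙ) = (a₁)₍₀₎ ⊗ ⋯ ⊗ (aₙ)₍₀₎ ⊗ (a₁)₍₁₎ ⋯ (aₙ)₍₁₎`, with `ρ₀(α) = α 1_Q`. -/
def comeasPow (ρ : A →ₗ[F] B ⊗[F] Q) : (n : ℕ) → (⨂[F]^n A) →ₗ[F] (⨂[F]^n B) ⊗[F] Q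
  | 0 =>
      TensorProduct.map (TensorPower.algebraMap₀ (R := F) (M := B)).toLinearMap
          (Algebra.linearMap F Q)
        ∘ₗ (TensorProduct.lid F F).symm.toLinearMap
        ∘ₗ (TensorPower.algebraMap₀ (R := F) (M := A)).symm.toLinearMap
  | n + 1 =>
      TensorProduct.map
          ((TensorPower.mulEquiv (R := F) (M := B) (n := n) (m := 1)).toLinearMap
            ∘ₗ TensorProduct.map LinearMap.id
              (PiTensorProduct.subsingletonEquiv (R := F) (s := fun _ => B) (0 : Fin 1)).symm.toLinearMap)
          (LinearMap.mul' F Q)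
        ∘ₗ (TensorProduct.tensorTensorTensorComm F (⨂[F]^n B) Q B Q).toLinearMap
        ∘ₗ TensorProduct.map (comeasPow ρ n)
          (ρ ∘ₗ (PiTensorProduct.subsingletonEquiv (R := F) (s := fun _ => A) (0 : Fin 1)).toLinearMap)
        ∘ₗ (TensorPower.mulEquiv (R := F) (M := A) (n := n) (m := 1)).symm.toLinearMap

/-- `ρ : A → B ⊗ Q` is a comeasuring of `Ω`-algebras:
`ρ_{t(ω)}(ω_A(x)) = (ω_B ⊗ id_Q)(ρ_{s(ω)}(x))`. -/
def IsComeasuring (𝒜 : OmegaAlgebra F s t A) (ℬ : OmegaAlgebra F s t B)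
    (ρ : A →ₗ[F] B ⊗[F] Q) : Prop :=
  ∀ (ω : Ω) (x : ⨂[F]^(s ω) A),
    comeasPow ρ (t ω) (𝒜.op ω x) = (ℬ.op ω).rTensor Q (comeasPow ρ (s ω) x)

/-- The map `Q* → Hom(A, B)`, `q* ↦ (a ↦ q*(a₍₁₎) a₍₀₎)`, attached to `ρ : A → B ⊗ Q`. -/
def coactToHom (ρ : A →ₗ[F] B ⊗[F] Q) : Module.Dual F Q →ₗ[F] A →ₗ[F] B where
  toFun q := (TensorProduct.rid F B).toLinearMap ∘ₗ q.lTensor B ∘ₗ ρ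
  map_add' q q' := by ext a; simp
  map_smul' c q := by ext a; simp

/-- The cosupport of `ρ : A → B ⊗ Q`. -/
def coactCosupp (ρ : A →ₗ[F] B ⊗[F] Q) : Submodule F (A →ₗ[F] B) :=
  LinearMap.range (coactToHom ρ)

end Comeasurings

/-- `(Q, ρ)` is a `V`-universal comeasuring algebra from `A` to `B`: an initial object in the
category of the comeasurings `ρ : A → B ⊗ Q`, over unital associative algebras `Q`, with
cosupport contained in `V`. -/
structure IsUniversalComeasuring {F : Type u} [Field F] {Ω : Type w} {s t : Ω → ℕ}
    {A : Type u} [AddCommGroup A] [Module F A] {B : Type u} [AddCommGroup B] [Module F B]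
    (𝒜 : OmegaAlgebra F s t A) (ℬ : OmegaAlgebra F s t B) (V : Submodule F (A →ₗ[F] B))
    {Q : Type u} [Ring Q] [Algebra F Q] (ρ : A →ₗ[F] B ⊗[F] Q) : Prop where
  isComeasuring : IsComeasuring 𝒜 ℬ ρ
  cosupp_le : coactCosupp ρ ≤ V
  initial : ∀ {Q' : Type u} [Ring Q'] [Algebra F Q'] (ρ' : A →ₗ[F] B ⊗[F] Q'),
    IsComeasuring 𝒜 ℬ ρ' → coactCosupp ρ' ≤ V →
      ∃! φ : Q →ₐ[F] Q', φ.toLinearMap.lTensor B ∘ₗ ρ = ρ'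

/-- `B` coacts on the `Ω`-algebra `A` through `ρ : A → A ⊗ B`: this is a counital right
`B`-comodule structure and a comeasuring. -/
structure IsCoaction {F : Type*} [Field F] {Ω : Type*} {s t : Ω → ℕ}
    {A : Type*} [AddCommGroup A] [Module F A] (𝒜 : OmegaAlgebra F s t A)
    {B : Type*} [Ring B] [Bialgebra F B] (ρ : A →ₗ[F] A ⊗[F] B) : Prop where
  counit_coact : (TensorProduct.rid F A).toLinearMap
    ∘ₗ (Coalgebra.counit (R := F) (A := B)).lTensor A ∘ₗ ρ = LinearMap.id
  coassoc : (TensorProduct.assoc F A B B).toLinearMap ∘ₗ ρ.rTensor B ∘ₗ ρ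
    = (Coalgebra.comul (R := F) (A := B)).lTensor A ∘ₗ ρ
  isComeasuring : IsComeasuring 𝒜 𝒜 ρ

/-- The bialgebra `B` with `ρ : A → A ⊗ B` is the `V`-universal coacting bialgebra `B^□(A, V)`: as
an algebra it is the `V`-universal comeasuring algebra from `A` to `A`, and its comultiplication
and counit are those that make `ρ` a coaction. -/
structure IsUniversalCoacting {F : Type u} [Field F] {Ω : Type w} {s t : Ω → ℕ}
    {A : Type u} [AddCommGroup A] [Module F A] (𝒜 : OmegaAlgebra F s t A)
    (V : Subalgebra F (Module.End F A))
    {B : Type u} [Ring B] [Bialgebra F B] (ρ : A →ₗ[F] A ⊗[F] B) : Prop where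
  isUniversalComeasuring : IsUniversalComeasuring 𝒜 𝒜 (Subalgebra.toSubmodule V) ρ
  isCoaction : IsCoaction 𝒜 ρ

/-! ### The subalgebra `V^#` -/

section Sharp

variable {F : Type*} [Field F] {A : Type*} [AddCommGroup A] [Module F A] [FiniteDimensional F A]

/-- The transpose `f* : A → A` of a linear map `f : A* → A*`, where `A** ` is identified with
`A` through evaluation. -/
def transposeEnd (f : Module.End F (Module.Dual F A)) : Module.End F A :=
  (Module.evalEquiv F A).symm.toLinearMap ∘ₗ f.dualMap ∘ₗ (Module.evalEquiv F A).toLinearMap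

lemma apply_transposeEnd (f : Module.End F (Module.Dual F A)) (α : Module.Dual F A) (a : A) :
    α (transposeEnd f a) = f α a := by
  simp [transposeEnd]

lemma transposeEnd_unique {f : Module.End F (Module.Dual F A)} {g : Module.End F A}
    (h : ∀ (α : Module.Dual F A) (a : A), α (g a) = f α a) : transposeEnd f = g := by
  ext a
  refine (Module.forall_dual_apply_eq_zero_iff F _).1 (fun α => ?_) |> sub_eq_zero.1
  rw [map_sub, apply_transposeEnd, h, sub_self]

/-- `V^# = {f* | f ∈ V}`. -/
def sharp (V : Subalgebra F (Module.End F (Module.Dual F A))) :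
    Subalgebra F (Module.End F A) where
  carrier := transposeEnd '' (V : Set (Module.End F (Module.Dual F A)))
  mul_mem' := by
    rintro _ _ ⟨f, hf, rfl⟩ ⟨g, hg, rfl⟩
    exact ⟨g * f, V.mul_mem hg hf, transposeEnd_unique fun α a => by
      simp [apply_transposeEnd]⟩
  add_mem' := by
    rintro _ _ ⟨f, hf, rfl⟩ ⟨g, hg, rfl⟩
    exact ⟨f + g, V.add_mem hf hg, transposeEnd_unique fun α a => by
      simp [apply_transposeEnd]⟩
  algebraMap_mem' c :=
    ⟨algebraMap F _ c, V.algebraMap_mem c, transposeEnd_unique fun α a => by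
      simp [Module.algebraMap_end_apply]⟩

end Sharp

/-! ### Opposite and co-opposite bialgebras -/

section Opposites

variable {F : Type*} [Field F]

/-- The opposite bialgebra `B^op`: the multiplication is reversed, the coalgebra is that of
`B`. -/
instance MulOpposite.instBialgebraOfRing (B : Type*) [Ring B] [Bialgebra F B] :
    Bialgebra F Bᵐᵒᵖ :=
  Bialgebra.mk' F Bᵐᵒᵖ
    (by rw [MulOpposite.counit_def]; simp)
    (by intro a b; rw [MulOpposite.counit_def]; simp [mul_comm])
    (by rw [MulOpposite.comul_def]; simp [Algebra.TensorProduct.one_def])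
    (by
      intro a b
      rw [MulOpposite.comul_def]
      simp only [LinearMap.comp_apply, LinearEquiv.coe_coe,
        MulOpposite.coe_opLinearEquiv_symm, MulOpposite.unop_mul, Bialgebra.comul_mul]
      generalize Coalgebra.comul (R := F) (MulOpposite.unop a) = x
      generalize Coalgebra.comul (R := F) (MulOpposite.unop b) = y
      induction x with
      | zero => simp
      | add x x' hx hx' => simp only [mul_add, add_mul, map_add, hx, hx']
      | tmul p q =>
        induction y with
        | zero => simp
        | add y y' hy hy' => simp only [mul_add, add_mul, map_add, hy, hy']
        | tmul p' q' => simp)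

/-- The underlying type of the co-opposite bialgebra `B^cop`. -/
def CoOpposite (B : Type*) : Type _ := B

instance (B : Type*) [Ring B] : Ring (CoOpposite B) := inferInstanceAs (Ring B)

instance (B : Type*) [Ring B] [Algebra F B] : Algebra F (CoOpposite B) :=
  inferInstanceAs (Algebra F B)

/-- The co-opposite coalgebra: the comultiplication is `b ↦ b₍₂₎ ⊗ b₍₁₎`, with the same counit. -/
instance (B : Type*) [Ring B] [Bialgebra F B] : Coalgebra F (CoOpposite B) where
  comul := ((TensorProduct.comm F B B).toLinearMap ∘ₗ Coalgebra.comul : B →ₗ[F] B ⊗[F] B)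
  counit := (Coalgebra.counit : B →ₗ[F] F)
  coassoc := by
    change (TensorProduct.assoc F B B B).toLinearMap ∘ₗ
      ((TensorProduct.comm F B B).toLinearMap ∘ₗ Coalgebra.comul).rTensor B ∘ₗ
        ((TensorProduct.comm F B B).toLinearMap ∘ₗ Coalgebra.comul) =
      ((TensorProduct.comm F B B).toLinearMap ∘ₗ Coalgebra.comul).lTensor B ∘ₗ
        ((TensorProduct.comm F B B).toLinearMap ∘ₗ Coalgebra.comul)
    have h1 : (Coalgebra.comul (R := F) (A := B)).rTensor B ∘ₗ
        (TensorProduct.comm F B B).toLinearMap = (TensorProduct.comm F B (B ⊗[F] B)).toLinearMap ∘ₗ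
          (Coalgebra.comul (R := F) (A := B)).lTensor B := by ext; simp
    have h2 : (Coalgebra.comul (R := F) (A := B)).lTensor B ∘ₗ
        (TensorProduct.comm F B B).toLinearMap = (TensorProduct.comm F (B ⊗[F] B) B).toLinearMap ∘ₗ
          (Coalgebra.comul (R := F) (A := B)).rTensor B := by ext; simp
    have h3 : (TensorProduct.assoc F B B B).toLinearMap ∘ₗ
        (TensorProduct.comm F B B).toLinearMap.rTensor B ∘ₗ
          (TensorProduct.comm F B (B ⊗[F] B)).toLinearMap ∘ₗ
            (TensorProduct.assoc F B B B).toLinearMap =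
        (TensorProduct.comm F B B).toLinearMap.lTensor B ∘ₗ
          (TensorProduct.comm F (B ⊗[F] B) B).toLinearMap := by
      apply TensorProduct.ext_threefold
      intro a b c
      simp
    ext b
    have e1 := fun x => LinearMap.congr_fun h1 x
    have e2 := fun x => LinearMap.congr_fun h2 x
    have e3 := fun x => LinearMap.congr_fun h3 x
    simp only [LinearMap.comp_apply, LinearEquiv.coe_coe] at e1 e2 e3
    simp only [LinearMap.rTensor_comp, LinearMap.lTensor_comp, LinearMap.comp_apply,
      LinearEquiv.coe_coe, e1, e2, ← e3, Coalgebra.coassoc_apply]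
  rTensor_counit_comp_comul := by
    change (Coalgebra.counit : B →ₗ[F] F).rTensor B ∘ₗ
      ((TensorProduct.comm F B B).toLinearMap ∘ₗ Coalgebra.comul) = TensorProduct.mk F F B 1
    rw [← LinearMap.comp_assoc, LinearMap.rTensor_comp_comm, LinearMap.comp_assoc,
      Coalgebra.lTensor_counit_comp_comul]
    ext; simp
  lTensor_counit_comp_comul := by
    change (Coalgebra.counit : B →ₗ[F] F).lTensor B ∘ₗ
      ((TensorProduct.comm F B B).toLinearMap ∘ₗ Coalgebra.comul) =
        (TensorProduct.mk F B F).flip 1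
    rw [← LinearMap.comp_assoc, LinearMap.lTensor_comp_comm, LinearMap.comp_assoc,
      Coalgebra.rTensor_counit_comp_comul]
    ext; simp

/-- The co-opposite bialgebra `B^cop`: the algebra is that of `B`, the coalgebra is the
co-opposite one. -/
instance (B : Type*) [Ring B] [Bialgebra F B] : Bialgebra F (CoOpposite B) :=
  Bialgebra.mk' F (CoOpposite B)
    (Bialgebra.counit_one (R := F) (A := B))
    (fun {a b} => Bialgebra.counit_mul (R := F) (A := B) a b)
    (by
      change TensorProduct.comm F B B (Coalgebra.comul (R := F) (1 : B)) = (1 : B ⊗[F] B)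
      simp [Algebra.TensorProduct.one_def])
    (by
      have h : ∀ a b : B, Algebra.TensorProduct.comm F B B (Coalgebra.comul (R := F) (a * b)) =
          Algebra.TensorProduct.comm F B B (Coalgebra.comul (R := F) a) *
            Algebra.TensorProduct.comm F B B (Coalgebra.comul (R := F) b) := by
        intro a b
        rw [Bialgebra.comul_mul, map_mul]
      intro a b
      exact h a b)

end Opposites

end

/-! Fix a basis `v` of `V`, finite because `A` is. A comeasuring `A → B ⊗ Q` with cosupport in `V`
is the same as a family `q` in `Q` with `ρ(a) = ∑ₖ vₖ(a) ⊗ qₖ` (`exists_eq_coactOf`), and the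
comeasuring identity becomes a set of polynomial relations among the `qₖ` (`comeasPow_coactOf`).
Hence the universal comeasuring algebra is a free algebra modulo these relations. If `V` is a unital
subalgebra of `End(A)`, the comeasurings built from `vᵢ ∘ vⱼ` and from the identity again have
cosupport in `V`; they induce the comultiplication and the counit, and uniqueness gives the
bialgebra axioms.

Measurings reduce to comeasurings. A measuring by `P` is a comeasuring with values in the
convolution algebra `P*` (`isMeasuring_actOf_convPairing_iff`). Algebra homomorphisms `Q → P*` are
pairings of `P` with `Q`, and these are the coalgebra homomorphisms `P → Q°` into the finite dual.
So `Q°` is the universal measuring coalgebra if `Q` is the universal comeasuring algebra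
(`IsUniversalFamily.isUniversalMeasuring`). Composition of measurings and the identity measuring by
`F` make it a bialgebra.

Transposition `End(A*) → End(A)` acts on each tensor factor separately. It therefore carries
(co)measurings of the dual structure to (co)measurings of `A` over the same coalgebra or algebra
(`isMeasuring_dual_iff`, `isComeasuring_dual_iff`), and the universal objects agree as coalgebras,
respectively algebras. It reverses composition (`transposeEquiv_comp`), and composition determines
the multiplication of the acting bialgebra and the comultiplication of the coacting one: hence `op`
and `cop`. -/

noncomputable section

/-! ### Tensor powers with the last factor split off -/

section TensorPowers

variable {F : Type*} [Field F] {M : Type*} [AddCommGroup M] [Module F M]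

lemma mulEquiv_tmul_subsingletonEquiv_symm {n : ℕ} (a : Fin n → M) (b : M) :
    TensorPower.mulEquiv (R := F) (M := M) (n := n) (m := 1)
      (PiTensorProduct.tprod F a ⊗ₜ
        (PiTensorProduct.subsingletonEquiv (R := F) (s := fun _ => M) (0 : Fin 1)).symm b) =
      PiTensorProduct.tprod F (Fin.snoc a b : Fin (n + 1) → M) := by
  have h : (PiTensorProduct.subsingletonEquiv (R := F) (s := fun _ => M) (0 : Fin 1)).symm b =
      PiTensorProduct.tprod F (fun _ : Fin 1 => b) := by
    rw [LinearEquiv.symm_apply_eq, PiTensorProduct.subsingletonEquiv_apply_tprod]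
  rw [h, ← TensorPower.gMul_def, TensorPower.tprod_mul_tprod]
  congr 1
  exact Fin.append_right_eq_snoc a _

lemma mulEquiv_symm_tprod_snoc {n : ℕ} (a : Fin n → M) (b : M) :
    (TensorPower.mulEquiv (R := F) (M := M) (n := n) (m := 1)).symm
      (PiTensorProduct.tprod F (Fin.snoc a b : Fin (n + 1) → M)) =
      PiTensorProduct.tprod F a ⊗ₜ
        (PiTensorProduct.subsingletonEquiv (R := F) (s := fun _ => M) (0 : Fin 1)).symm b := by
  rw [LinearEquiv.symm_apply_eq, mulEquiv_tmul_subsingletonEquiv_symm]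

lemma algebraMap₀_apply (c : F) :
    TensorPower.algebraMap₀ (R := F) (M := M) c = c • PiTensorProduct.tprod F (Fin.elim0) := by
  rw [TensorPower.algebraMap₀_eq_smul_one]; rfl

end TensorPowers

/-! ### Comeasurings as finite families of coefficients -/

section CoactOf

variable {F : Type*} [Field F]
variable {A : Type*} [AddCommGroup A] [Module F A] {B : Type*} [AddCommGroup B] [Module F B]
variable {K : Type*} [Fintype K] {Q : Type*} [Ring Q] [Algebra F Q]

/-- The map `a ↦ ∑ₖ fₖ(a) ⊗ qₖ`. -/
def coactOf (f : K → A →ₗ[F] B) (q : K → Q) : A →ₗ[F] B ⊗[F] Q :=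
  ∑ k, (TensorProduct.mk F B Q).flip (q k) ∘ₗ f k

@[simp]
lemma coactOf_apply (f : K → A →ₗ[F] B) (q : K → Q) (a : A) :
    coactOf f q a = ∑ k, f k a ⊗ₜ q k := by
  simp [coactOf]

/-- Expanding a product of `n` sums gives one term for each word `k` of length `n` in `K`. The
recursion of `comeasPow` splits off the last tensor factor, so the induction appends a last letter
to the word. -/
lemma comeasPow_coactOf (f : K → A →ₗ[F] B) (q : K → Q) (n : ℕ) (x : ⨂[F]^n A) :
    comeasPow (coactOf f q) n x =
      ∑ k : Fin n → K, PiTensorProduct.map (fun i => f (k i)) x ⊗ₜ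
        (List.ofFn (fun i => q (k i))).prod := by
  induction n with
  | zero =>
    induction x using PiTensorProduct.induction_on with
    | add x y hx hy => simp only [map_add, hx, hy, TensorProduct.add_tmul, Finset.sum_add_distrib]
    | smul_tprod r a =>
      have : (TensorPower.algebraMap₀ (R := F) (M := A)).symm (PiTensorProduct.tprod F a) = 1 := by
        rw [LinearEquiv.symm_apply_eq, algebraMap₀_apply, one_smul]
        congr 1
        exact Subsingleton.elim _ _
      simp only [map_smul, comeasPow, LinearMap.comp_apply, LinearEquiv.coe_coe, this]
      simp only [TensorProduct.lid_symm_apply, TensorProduct.map_tmul, LinearEquiv.coe_coe,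
        algebraMap₀_apply, Algebra.linearMap_apply, map_one, one_smul, List.ofFn_zero,
        List.prod_nil, PiTensorProduct.map_tprod, TensorProduct.smul_tmul', Finset.univ_unique,
        Finset.sum_singleton]
      congr 3
      exact Subsingleton.elim _ _
  | succ n ih =>
    induction x using PiTensorProduct.induction_on with
    | add x y hx hy => simp only [map_add, hx, hy, TensorProduct.add_tmul, Finset.sum_add_distrib]
    | smul_tprod r a =>
      rw [map_smul]
      simp only [map_smul, ← TensorProduct.smul_tmul', ← Finset.smul_sum]
      congr 1
      rw [← Fin.snoc_init_self a]
      generalize Fin.init a = a'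
      generalize a (Fin.last n) = b
      simp only [comeasPow, LinearMap.comp_apply, LinearEquiv.coe_coe, mulEquiv_symm_tprod_snoc,
        TensorProduct.map_tmul, ih, LinearEquiv.apply_symm_apply, coactOf_apply,
        TensorProduct.sum_tmul, TensorProduct.tmul_sum, map_sum, PiTensorProduct.map_tprod,
        TensorProduct.tensorTensorTensorComm_tmul, LinearMap.id_apply,
        mulEquiv_tmul_subsingletonEquiv_symm, LinearMap.mul'_apply]
      rw [← Fintype.sum_prod_type' (f := fun (k : K) (l : Fin n → K) => _)]
      refine Fintype.sum_equiv (Fin.snocEquiv (fun _ => K)) _ _ fun p => ?_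
      obtain ⟨k, l⟩ := p
      rw [List.ofFn_succ']
      simp only [Fin.snocEquiv_apply, Fin.snoc_castSucc, Fin.snoc_last, List.concat_eq_append,
        List.prod_append, List.prod_singleton]
      congr 2
      funext i
      refine Fin.lastCases ?_ (fun i => ?_) i <;> simp

end CoactOf

section CoactOf

variable {F : Type*} [Field F]
variable {A : Type*} [AddCommGroup A] [Module F A] {B : Type*} [AddCommGroup B] [Module F B]
variable {K : Type*} [Fintype K] {Q : Type*} [Ring Q] [Algebra F Q]

lemma eq_of_forall_dual_eq {M : Type*} [AddCommGroup M] [Module F M] {x y : M}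
    (h : ∀ α : Module.Dual F M, α x = α y) : x = y :=
  sub_eq_zero.1 <| (Module.forall_dual_apply_eq_zero_iff F _).1 fun α => by
    rw [map_sub, h, sub_self]

lemma lTensor_coactOf {X : Type*} [Ring X] [Algebra F X] (g : Q →ₗ[F] X)
    (f : K → A →ₗ[F] B) (q : K → Q) :
    g.lTensor B ∘ₗ coactOf f q = coactOf f (fun k => g (q k)) := by
  ext a; simp

lemma coactToHom_coactOf (f : K → A →ₗ[F] B) (q : K → Q) (α : Module.Dual F Q) :
    coactToHom (coactOf f q) α = ∑ k, α (q k) • f k := by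
  ext a; simp [coactToHom]

lemma coactCosupp_coactOf_le {V : Submodule F (A →ₗ[F] B)} {f : K → A →ₗ[F] B}
    (hf : ∀ k, f k ∈ V) (q : K → Q) : coactCosupp (coactOf f q) ≤ V := by
  rintro _ ⟨α, rfl⟩
  rw [coactToHom_coactOf]
  exact V.sum_mem fun k _ => V.smul_mem _ (hf k)

lemma coeff_eq_of_sum_smul_eq {f : K → A →ₗ[F] B} (hf : LinearIndependent F f) {c d : K → F}
    (h : ∑ k, c k • f k = ∑ k, d k • f k) (k : K) : c k = d k :=
  hf.eq_coords_of_eq h k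

/-- A functional `α` on `Q` turns the coaction into `∑ₖ α(qₖ) fₖ`, whose coefficients are determined
by independence; functionals separate the points of `Q`. -/
lemma coactOf_injective {f : K → A →ₗ[F] B} (hf : LinearIndependent F f) {q q' : K → Q}
    (h : coactOf f q = coactOf f q') : q = q' := by
  funext k
  refine eq_of_forall_dual_eq (F := F) fun α => ?_
  have := congrArg (fun ρ => coactToHom ρ α) h
  simp only [coactToHom_coactOf] at this
  exact coeff_eq_of_sum_smul_eq hf this k

lemma linearIndependent_coe_basis {K : Type*} {V : Submodule F (A →ₗ[F] B)}
    (v : Module.Basis K F V) :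
    LinearIndependent F (fun k => (v k : A →ₗ[F] B)) :=
  v.linearIndependent.map' V.subtype (Submodule.ker_subtype V)

/-- Since `A` is finite dimensional, `Hom(A, B ⊗ Q) ≅ Hom(A, B) ⊗ Q`, so `ρ` is a finite sum of `bᵢ
⊗ Cᵢ` with `C` a basis of `Q`. The coordinate functional of `Cᵢ` exhibits `bᵢ` as an element of the
cosupport, hence of `V`, and it can be expanded in `v`. -/
lemma exists_eq_coactOf [FiniteDimensional F A] {V : Submodule F (A →ₗ[F] B)}
    (v : Module.Basis K F V) {ρ : A →ₗ[F] B ⊗[F] Q} (h : coactCosupp ρ ≤ V) :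
    ∃ q : K → Q, ρ = coactOf (fun k => (v k : A →ₗ[F] B)) q := by
  classical
  let C := Module.Basis.ofVectorSpace F Q
  obtain ⟨z, rfl⟩ := (rTensorHomEquivHomRTensor F A B Q).surjective ρ
  obtain ⟨b, rfl⟩ := (TensorProduct.equivFinsuppOfBasisRight C).symm.surjective z
  set ρ := rTensorHomEquivHomRTensor F A B Q
    ((TensorProduct.equivFinsuppOfBasisRight C).symm b) with hρdef
  have hρ : ∀ a, ρ a = ∑ i ∈ b.support, b i a ⊗ₜ C i := by
    intro a
    rw [hρdef, rTensorHomEquivHomRTensor_apply, TensorProduct.equivFinsuppOfBasisRight_symm_apply,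
      Finsupp.sum, map_sum, LinearMap.sum_apply]
    exact Finset.sum_congr rfl fun i _ => by simp [TensorProduct.rTensorHomToHomRTensor_apply]
  have hb : ∀ i ∈ b.support, b i ∈ V := by
    intro i hi
    refine h ⟨C.coord i, ?_⟩
    ext a
    simp only [coactToHom, LinearMap.coe_mk, AddHom.coe_mk, LinearMap.comp_apply, hρ, map_sum,
      LinearMap.lTensor_tmul, LinearEquiv.coe_coe, TensorProduct.rid_tmul, Module.Basis.coord_apply,
      Module.Basis.repr_self]
    rw [Finset.sum_eq_single i]
    · simp
    · intro j _ hj; simp [hj]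
    · intro h; exact absurd hi h
  refine ⟨fun k => ∑ i ∈ b.support.attach, v.repr ⟨b i, hb i i.2⟩ k • C i, ?_⟩
  ext a
  rw [hρ, coactOf_apply]
  simp only [TensorProduct.tmul_sum]
  rw [Finset.sum_comm, ← Finset.sum_attach]
  refine Finset.sum_congr rfl fun i _ => ?_
  have := congrArg (fun x : V => (x : A →ₗ[F] B) a) (v.sum_repr ⟨b i, hb i i.2⟩)
  simp only [TensorProduct.tmul_smul, TensorProduct.smul_tmul']
  rw [← TensorProduct.sum_tmul]
  congr 1
  refine this.symm.trans ?_
  simp only [Submodule.coe_sum, Submodule.coe_smul, LinearMap.sum_apply, LinearMap.smul_apply]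

end CoactOf

/-! ### Comeasurings under algebra maps and composition -/

section Families

variable {F : Type*} [Field F] {Ω : Type*} {s t : Ω → ℕ}
variable {A : Type*} [AddCommGroup A] [Module F A] {B : Type*} [AddCommGroup B] [Module F B]
  {C : Type*} [AddCommGroup C] [Module F C]
variable {K : Type*} [Fintype K] {K' : Type*} [Fintype K']
variable {Q : Type*} [Ring Q] [Algebra F Q] {Q' : Type*} [Ring Q'] [Algebra F Q']
variable {𝒜 : OmegaAlgebra F s t A} {ℬ : OmegaAlgebra F s t B} {𝒞 : OmegaAlgebra F s t C}

lemma isComeasuring_coactOf_iff (f : K → A →ₗ[F] B) (q : K → Q) :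
    IsComeasuring 𝒜 ℬ (coactOf f q) ↔ ∀ (ω : Ω) (x : ⨂[F]^(s ω) A),
      ∑ k : Fin (t ω) → K, PiTensorProduct.map (fun i => f (k i)) (𝒜.op ω x) ⊗ₜ[F]
        (List.ofFn (fun i => q (k i))).prod =
      ∑ k : Fin (s ω) → K, ℬ.op ω (PiTensorProduct.map (fun i => f (k i)) x) ⊗ₜ[F]
        (List.ofFn (fun i => q (k i))).prod := by
  simp [IsComeasuring, comeasPow_coactOf]

lemma isComeasuring_coactOf_map {f : K → A →ₗ[F] B} {q : K → Q} (φ : Q →ₐ[F] Q')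
    (h : IsComeasuring 𝒜 ℬ (coactOf f q)) :
    IsComeasuring 𝒜 ℬ (coactOf f (fun k => φ (q k))) := by
  rw [isComeasuring_coactOf_iff] at h ⊢
  intro ω x
  simpa [List.map_ofFn, Function.comp_def, map_list_prod] using
    congrArg (φ.toLinearMap.lTensor _) (h ω x)

lemma list_prod_ofFn_tmul {n : ℕ} (q : Fin n → Q) (q' : Fin n → Q') :
    (List.ofFn (fun i => q i ⊗ₜ[F] q' i)).prod =
      (List.ofFn q).prod ⊗ₜ[F] (List.ofFn q').prod := by
  induction n with
  | zero => simp [Algebra.TensorProduct.one_def]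
  | succ n ih => simp [List.ofFn_succ, ih]

lemma sum_pi_prod {M : Type*} [AddCommMonoid M] {n : ℕ} (g : (Fin n → K) → (Fin n → K') → M) :
    ∑ k : Fin n → K × K', g (fun i => (k i).1) (fun i => (k i).2) = ∑ k, ∑ l, g k l := by
  rw [← Fintype.sum_prod_type']
  exact Fintype.sum_equiv (Equiv.arrowProdEquivProdArrow (Fin n) (fun _ => K) (fun _ => K'))
    _ _ fun _ => rfl

/-- Words in `K × K'` are pairs of words, and the product of pure tensors in `Q ⊗ Q'` splits
accordingly. This is the source of the comultiplication on coacting bialgebras and of the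
multiplication on acting ones. -/
lemma isComeasuring_coactOf_comp {f : K → B →ₗ[F] C} {q : K → Q} {g : K' → A →ₗ[F] B}
    {q' : K' → Q'} (hf : IsComeasuring ℬ 𝒞 (coactOf f q)) (hg : IsComeasuring 𝒜 ℬ (coactOf g q')) :
    IsComeasuring 𝒜 𝒞 (coactOf (fun p : K × K' => f p.1 ∘ₗ g p.2)
      (fun p => q p.1 ⊗ₜ[F] q' p.2)) := by
  rw [isComeasuring_coactOf_iff] at hf hg ⊢
  intro ω x
  have key : ∀ (n : ℕ) (k : Fin n → K × K') (y : ⨂[F]^n A),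
      PiTensorProduct.map (fun i => f (k i).1 ∘ₗ g (k i).2) y =
      PiTensorProduct.map (fun i => f (k i).1) (PiTensorProduct.map (fun i => g (k i).2) y) := by
    intro n k y; rw [PiTensorProduct.map_comp]; rfl
  simp only [key, list_prod_ofFn_tmul]
  rw [sum_pi_prod (fun k l => PiTensorProduct.map (fun i => f (k i))
      (PiTensorProduct.map (fun i => g (l i)) (𝒜.op ω x)) ⊗ₜ[F]
        ((List.ofFn fun i => q (k i)).prod ⊗ₜ[F] (List.ofFn fun i => q' (l i)).prod)),
    sum_pi_prod (fun k l => 𝒞.op ω (PiTensorProduct.map (fun i => f (k i))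
      (PiTensorProduct.map (fun i => g (l i)) x)) ⊗ₜ[F]
        ((List.ofFn fun i => q (k i)).prod ⊗ₜ[F] (List.ofFn fun i => q' (l i)).prod))]
  -- The operation first passes the inner family, for each fixed outer word `k`, and then the outer
  -- family, for each fixed inner word `l`.
  have h1 : ∀ k : Fin (t ω) → K, _ := fun k => congrArg (TensorProduct.map
    (PiTensorProduct.map (fun i => f (k i)))
    (TensorProduct.mk F Q Q' (List.ofFn fun i => q (k i)).prod)) (hg ω x)
  have h2 : ∀ l : Fin (s ω) → K', _ := fun l => congrArg
    ((TensorProduct.assoc F _ Q Q').toLinearMap ∘ₗ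
    (TensorProduct.mk F _ Q').flip (List.ofFn fun i => q' (l i)).prod)
    (hf ω (PiTensorProduct.map (fun i => g (l i)) x))
  simp only [map_sum, TensorProduct.map_tmul, TensorProduct.mk_apply, LinearMap.comp_apply,
    LinearMap.flip_apply, LinearEquiv.coe_coe, TensorProduct.assoc_tmul] at h1 h2
  rw [Finset.sum_congr rfl fun k _ => h1 k, Finset.sum_comm, Finset.sum_congr rfl fun l _ => h2 l,
    Finset.sum_comm]

lemma isComeasuring_coactOf_id :
    IsComeasuring 𝒜 𝒜 (coactOf (fun _ : Unit => LinearMap.id) (fun _ => (1 : Q)) :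
      A →ₗ[F] A ⊗[F] Q) := by
  rw [isComeasuring_coactOf_iff]
  intro ω x
  simp

end Families

/-- The algebra `Q` with the family `q` is universal among the algebras with a family `q` for which
`a ↦ ∑ₖ vₖ(a) ⊗ qₖ` is a comeasuring. -/
structure IsUniversalFamily {F : Type u} [Field F] {Ω : Type w} {s t : Ω → ℕ}
    {A : Type u} [AddCommGroup A] [Module F A] {B : Type u} [AddCommGroup B] [Module F B]
    (𝒜 : OmegaAlgebra F s t A) (ℬ : OmegaAlgebra F s t B) {K : Type*} [Fintype K]
    (v : K → A →ₗ[F] B) {Q : Type u} [Ring Q] [Algebra F Q] (q : K → Q) : Prop where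
  isComeasuring : IsComeasuring 𝒜 ℬ (coactOf v q)
  initial : ∀ {Q' : Type u} [Ring Q'] [Algebra F Q'] (q' : K → Q'),
    IsComeasuring 𝒜 ℬ (coactOf v q') → ∃! φ : Q →ₐ[F] Q', ∀ k, φ (q k) = q' k

/-! ### Existence by generators and relations -/

section Existence

variable {F : Type u} [Field F] {Ω : Type w} {s t : Ω → ℕ}
  {A : Type u} [AddCommGroup A] [Module F A] {B : Type u} [AddCommGroup B] [Module F B]
  {𝒜 : OmegaAlgebra F s t A} {ℬ : OmegaAlgebra F s t B} {K : Type*} [Fintype K]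

/-- Every competing comeasuring comes from a family, and independence of `v` turns compatibility
with the comeasurings into `φ (q k) = q' k`. -/
lemma isUniversalComeasuring_iff [FiniteDimensional F A] {V : Submodule F (A →ₗ[F] B)}
    (v : Module.Basis K F V) {Q : Type u} [Ring Q] [Algebra F Q] (q : K → Q) :
    IsUniversalComeasuring 𝒜 ℬ V (coactOf (fun k => (v k : A →ₗ[F] B)) q) ↔
      IsUniversalFamily 𝒜 ℬ (fun k => (v k : A →ₗ[F] B)) q := by
  have hv := linearIndependent_coe_basis v
  have hiff : ∀ {Q' : Type u} [Ring Q'] [Algebra F Q'] (φ : Q →ₐ[F] Q') (q' : K → Q'),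
      φ.toLinearMap.lTensor B ∘ₗ coactOf (fun k => (v k : A →ₗ[F] B)) q =
        coactOf (fun k => (v k : A →ₗ[F] B)) q' ↔ ∀ k, φ (q k) = q' k := by
    intro Q' _ _ φ q'
    rw [lTensor_coactOf]
    exact ⟨fun h => congrFun (coactOf_injective hv h), fun h => congrArg _ (funext h)⟩
  constructor
  · intro h
    refine ⟨h.isComeasuring, fun q' hq' => ?_⟩
    simpa only [hiff] using
      h.initial (coactOf (fun k => (v k : A →ₗ[F] B)) q') hq'
        (coactCosupp_coactOf_le (fun k => (v k).2) _)
  · intro h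
    refine ⟨h.isComeasuring, coactCosupp_coactOf_le (fun k => (v k).2) _, fun ρ' hρ' hV => ?_⟩
    obtain ⟨q', rfl⟩ := exists_eq_coactOf v hV
    simpa only [hiff] using h.initial q' hρ'

/-- The defining relations of the universal comeasuring algebra. -/
inductive ComeasRel (𝒜 : OmegaAlgebra F s t A) (ℬ : OmegaAlgebra F s t B) (v : K → A →ₗ[F] B) :
    FreeAlgebra F K → FreeAlgebra F K → Prop
  | op (ω : Ω) (x : ⨂[F]^(s ω) A) (β : Module.Dual F (⨂[F]^(t ω) B)) :
    ComeasRel 𝒜 ℬ v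
      (∑ k : Fin (t ω) → K, β (PiTensorProduct.map (fun i => v (k i)) (𝒜.op ω x)) •
        (List.ofFn (fun i => FreeAlgebra.ι F (k i))).prod)
      (∑ k : Fin (s ω) → K, β (ℬ.op ω (PiTensorProduct.map (fun i => v (k i)) x)) •
        (List.ofFn (fun i => FreeAlgebra.ι F (k i))).prod)

lemma tensor_ext_dual_left {M N : Type*} [AddCommGroup M] [Module F M] [AddCommGroup N] [Module F N]
    {y z : M ⊗[F] N}
    (h : ∀ β : Module.Dual F M, TensorProduct.lid F N (β.rTensor N y) =
      TensorProduct.lid F N (β.rTensor N z)) : y = z := by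
  classical
  let C := Module.Basis.ofVectorSpace F M
  refine (TensorProduct.equivFinsuppOfBasisLeft C).injective (Finsupp.ext fun i => ?_)
  rw [TensorProduct.equivFinsuppOfBasisLeft_apply, TensorProduct.equivFinsuppOfBasisLeft_apply]
  exact h _

/-- Functionals on the left factor separate tensors, so the relations, one for each `ω`, `x` and
`β`, together say exactly that the family is a comeasuring. Indexing by `Fin n` keeps the quotient
of the free algebra in `Type u`. -/
lemma exists_isUniversalFamily (𝒜 : OmegaAlgebra F s t A) (ℬ : OmegaAlgebra F s t B) {n : ℕ}
    (v : Fin n → A →ₗ[F] B) :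
    ∃ (Q : Type u) (_ : Ring Q) (_ : Algebra F Q) (q : Fin n → Q), IsUniversalFamily 𝒜 ℬ v q := by
  let π := RingQuot.mkAlgHom F (ComeasRel 𝒜 ℬ v)
  refine ⟨RingQuot (ComeasRel 𝒜 ℬ v), inferInstance, inferInstance,
    fun k => π (FreeAlgebra.ι F k), ?_, ?_⟩
  · rw [isComeasuring_coactOf_iff]
    intro ω x
    refine tensor_ext_dual_left fun β => ?_
    have := RingQuot.mkAlgHom_rel F (ComeasRel.op (𝒜 := 𝒜) (ℬ := ℬ) (v := v) ω x β)
    simpa [π, map_list_prod, List.map_ofFn, Function.comp_def] using this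
  · intro Q' _ _ q' hq'
    rw [isComeasuring_coactOf_iff] at hq'
    refine ⟨RingQuot.liftAlgHom F ⟨FreeAlgebra.lift F q', ?_⟩, fun k => ?_, fun φ hφ => ?_⟩
    · rintro _ _ ⟨ω, x, β⟩
      have := congrArg ((TensorProduct.lid F Q').toLinearMap ∘ₗ β.rTensor Q') (hq' ω x)
      simpa [map_list_prod, List.map_ofFn, Function.comp_def] using this
    · simp [π]
    · refine RingQuot.liftAlgHom_unique F _ _ _ (FreeAlgebra.hom_ext (funext fun k => ?_))
      simpa [π] using hφ k

end Existence

/-! ### The universal coacting bialgebra -/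

section Coacting

variable {F : Type u} [Field F] {Ω : Type w} {s t : Ω → ℕ}
  {A : Type u} [AddCommGroup A] [Module F A]

/-- The universal comeasuring pushed forward along `φ'` is a comeasuring with cosupport in `V`, and
both maps solve the initiality problem for it. -/
lemma IsUniversalComeasuring.hom_ext [FiniteDimensional F A] {B : Type u} [AddCommGroup B]
    [Module F B] [FiniteDimensional F B] {𝒜 : OmegaAlgebra F s t A} {ℬ : OmegaAlgebra F s t B}
    {V : Submodule F (A →ₗ[F] B)}
    {Q : Type u} [Ring Q] [Algebra F Q] {ρ : A →ₗ[F] B ⊗[F] Q}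
    (h : IsUniversalComeasuring 𝒜 ℬ V ρ) {Q' : Type u} [Ring Q'] [Algebra F Q'] {φ φ' : Q →ₐ[F] Q'}
    (hφ : φ.toLinearMap.lTensor B ∘ₗ ρ = φ'.toLinearMap.lTensor B ∘ₗ ρ) : φ = φ' := by
  let v := Module.finBasis F V
  obtain ⟨q, rfl⟩ := exists_eq_coactOf v h.cosupp_le
  refine (h.initial _ ?_ ?_).unique hφ rfl
  · rw [lTensor_coactOf]
    exact isComeasuring_coactOf_map φ' h.isComeasuring
  · rw [lTensor_coactOf]
    exact coactCosupp_coactOf_le (fun k => (v k).2) _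

variable {K : Type*} [Fintype K] {Q : Type u} [Ring Q] [Algebra F Q]
  {f : K → A →ₗ[F] A} {q : K → Q} {Δ : Q →ₐ[F] Q ⊗[F] Q} {ε : Q →ₐ[F] F}

lemma lTensor_algHom_coactOf_apply {Q' : Type*} [Ring Q'] [Algebra F Q'] (φ : Q →ₐ[F] Q') (a : A) :
    (φ.toLinearMap.lTensor A ∘ₗ coactOf f q) a = ∑ k, f k a ⊗ₜ φ (q k) := by
  simp

/-- Both sides equal `∑ fᵢ fⱼ fₗ(a) ⊗ (qᵢ ⊗ (qⱼ ⊗ qₗ))`: on the left `hΔ` is used a second time at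
the points `fⱼ(a)`, on the right under the outer map `fᵢ`. -/
lemma coassoc_on_generators
    (hΔ : ∀ a, ∑ k, f k a ⊗ₜ[F] Δ (q k) = ∑ i, ∑ j, f i (f j a) ⊗ₜ[F] (q i ⊗ₜ[F] q j)) (a : A) :
    ∑ k, f k a ⊗ₜ[F] TensorProduct.assoc F Q Q Q (Δ.toLinearMap.rTensor Q (Δ (q k))) =
      ∑ k, f k a ⊗ₜ[F] Δ.toLinearMap.lTensor Q (Δ (q k)) := by
  have h1 := congrArg (((TensorProduct.assoc F Q Q Q).toLinearMap ∘ₗ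
    Δ.toLinearMap.rTensor Q).lTensor A) (hΔ a)
  have h2 := congrArg ((Δ.toLinearMap.lTensor Q).lTensor A) (hΔ a)
  have h3 : ∀ j, _ := fun j => congrArg (((TensorProduct.assoc F Q Q Q).toLinearMap ∘ₗ
    (TensorProduct.mk F (Q ⊗[F] Q) Q).flip (q j)).lTensor A) (hΔ (f j a))
  have h4 : ∀ i, _ := fun i => congrArg (TensorProduct.map (f i)
    (TensorProduct.mk F Q (Q ⊗[F] Q) (q i))) (hΔ a)
  simp only [map_sum, LinearMap.lTensor_tmul, LinearMap.comp_apply, LinearEquiv.coe_coe,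
    TensorProduct.assoc_tmul, LinearMap.rTensor_tmul, AlgHom.toLinearMap_apply,
    TensorProduct.map_tmul, LinearMap.flip_apply, TensorProduct.mk_apply] at h1 h2 h3 h4
  rw [Finset.sum_comm, Finset.sum_congr rfl fun j _ => h3 j] at h1
  rw [Finset.sum_congr rfl fun i _ => h4 i] at h2
  refine h1.trans (Eq.trans ?_ h2.symm)
  rw [Finset.sum_comm]
  exact Finset.sum_congr rfl fun i _ => Finset.sum_comm

lemma rTensor_counit_on_generators
    (hΔ : ∀ a, ∑ k, f k a ⊗ₜ[F] Δ (q k) = ∑ i, ∑ j, f i (f j a) ⊗ₜ[F] (q i ⊗ₜ[F] q j))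
    (hε : ∀ a, ∑ k, f k a ⊗ₜ[F] ε (q k) = a ⊗ₜ[F] (1 : F)) (a : A) :
    ∑ k, f k a ⊗ₜ[F] ε.toLinearMap.rTensor Q (Δ (q k)) = ∑ k, f k a ⊗ₜ[F] (1 ⊗ₜ[F] q k) := by
  have h1 := congrArg ((ε.toLinearMap.rTensor Q).lTensor A) (hΔ a)
  have h3 : ∀ j, _ := fun j => congrArg
    (((TensorProduct.mk F F Q).flip (q j)).lTensor A) (hε (f j a))
  simp only [map_sum, LinearMap.lTensor_tmul, LinearMap.rTensor_tmul,
    AlgHom.toLinearMap_apply, LinearMap.flip_apply, TensorProduct.mk_apply] at h1 h3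
  rwa [Finset.sum_comm, Finset.sum_congr rfl fun j _ => h3 j] at h1

lemma lTensor_counit_on_generators
    (hΔ : ∀ a, ∑ k, f k a ⊗ₜ[F] Δ (q k) = ∑ i, ∑ j, f i (f j a) ⊗ₜ[F] (q i ⊗ₜ[F] q j))
    (hε : ∀ a, ∑ k, f k a ⊗ₜ[F] ε (q k) = a ⊗ₜ[F] (1 : F)) (a : A) :
    ∑ k, f k a ⊗ₜ[F] ε.toLinearMap.lTensor Q (Δ (q k)) = ∑ k, f k a ⊗ₜ[F] (q k ⊗ₜ[F] 1) := by
  have h2 := congrArg ((ε.toLinearMap.lTensor Q).lTensor A) (hΔ a)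
  have h4 : ∀ i, _ := fun i => congrArg (TensorProduct.map (f i)
    (TensorProduct.mk F Q F (q i))) (hε a)
  simp only [map_sum, LinearMap.lTensor_tmul, AlgHom.toLinearMap_apply,
    TensorProduct.map_tmul, TensorProduct.mk_apply] at h2 h4
  rwa [Finset.sum_congr rfl fun i _ => h4 i] at h2

/-- The bialgebra structure on a universal comeasuring algebra given by a comultiplication and a
counit compatible with the universal comeasuring. -/
abbrev bialgebraOfIsUniversalComeasuring [FiniteDimensional F A] {𝒜 : OmegaAlgebra F s t A}
    {V : Submodule F (A →ₗ[F] A)} (hU : IsUniversalComeasuring 𝒜 𝒜 V (coactOf f q))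
    (hΔ : ∀ a, ∑ k, f k a ⊗ₜ[F] Δ (q k) = ∑ i, ∑ j, f i (f j a) ⊗ₜ[F] (q i ⊗ₜ[F] q j))
    (hε : ∀ a, ∑ k, f k a ⊗ₜ[F] ε (q k) = a ⊗ₜ[F] (1 : F)) : Bialgebra F Q :=
  Bialgebra.ofAlgHom Δ ε
    (hU.hom_ext (LinearMap.ext fun a => by
      rw [lTensor_algHom_coactOf_apply, lTensor_algHom_coactOf_apply]
      exact coassoc_on_generators hΔ a))
    (hU.hom_ext (LinearMap.ext fun a => by
      rw [lTensor_algHom_coactOf_apply, lTensor_algHom_coactOf_apply]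
      exact rTensor_counit_on_generators hΔ hε a))
    (hU.hom_ext (LinearMap.ext fun a => by
      rw [lTensor_algHom_coactOf_apply, lTensor_algHom_coactOf_apply]
      exact lTensor_counit_on_generators hΔ hε a))

lemma isUniversalCoacting_coactOf [FiniteDimensional F A] {𝒜 : OmegaAlgebra F s t A}
    {V : Subalgebra F (Module.End F A)}
    (hU : IsUniversalComeasuring 𝒜 𝒜 (Subalgebra.toSubmodule V) (coactOf f q))
    (hΔ : ∀ a, ∑ k, f k a ⊗ₜ[F] Δ (q k) = ∑ i, ∑ j, f i (f j a) ⊗ₜ[F] (q i ⊗ₜ[F] q j))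
    (hε : ∀ a, ∑ k, f k a ⊗ₜ[F] ε (q k) = a ⊗ₜ[F] (1 : F)) :
    letI := bialgebraOfIsUniversalComeasuring hU hΔ hε
    IsUniversalCoacting 𝒜 V (coactOf f q) := by
  let _ := bialgebraOfIsUniversalComeasuring hU hΔ hε
  have hcomul : ∀ x : Q, Coalgebra.comul (R := F) x = Δ x := fun _ => rfl
  have hcounit : ∀ x : Q, Coalgebra.counit (R := F) x = ε x := fun _ => rfl
  refine ⟨hU, ?_, ?_, hU.isComeasuring⟩
  · ext a
    have := congrArg (TensorProduct.rid F A) (hε a)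
    simpa [hcounit] using this
  · ext a
    simp only [LinearMap.comp_apply, coactOf_apply, map_sum, LinearMap.rTensor_tmul,
      LinearMap.lTensor_tmul, hcomul, hΔ, TensorProduct.sum_tmul, LinearEquiv.coe_coe,
      TensorProduct.assoc_tmul]
    exact Finset.sum_comm

/-- Closure of `V` under composition admits the twofold comeasuring into `Q ⊗ Q`, which yields `Δ`;
the identity in `V` admits `a ↦ a ⊗ 1` into `F`, which yields `ε`. -/
theorem IsUniversalComeasuring.exists_isUniversalCoacting [FiniteDimensional F A]
    {𝒜 : OmegaAlgebra F s t A} {V : Subalgebra F (Module.End F A)} (hf : ∀ k, f k ∈ V)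
    (hU : IsUniversalComeasuring 𝒜 𝒜 (Subalgebra.toSubmodule V) (coactOf f q)) :
    ∃ (B : Type u) (_ : Ring B) (_ : Bialgebra F B) (ρ : A →ₗ[F] A ⊗[F] B),
      IsUniversalCoacting 𝒜 V ρ := by
  have hΔV : ∀ p : K × K, f p.1 ∘ₗ f p.2 ∈ Subalgebra.toSubmodule V :=
    fun p => V.mul_mem (hf p.1) (hf p.2)
  have hεV : ∀ _ : Unit, (LinearMap.id : A →ₗ[F] A) ∈ Subalgebra.toSubmodule V :=
    fun _ => V.one_mem
  obtain ⟨Δ, hΔ, -⟩ := hU.initial _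
    (isComeasuring_coactOf_comp hU.isComeasuring hU.isComeasuring)
    (coactCosupp_coactOf_le hΔV _)
  obtain ⟨ε, hε, -⟩ := hU.initial (Q' := F) _ isComeasuring_coactOf_id
    (coactCosupp_coactOf_le hεV _)
  have hΔ' : ∀ a, ∑ k, f k a ⊗ₜ[F] Δ (q k) = ∑ i, ∑ j, f i (f j a) ⊗ₜ[F] (q i ⊗ₜ[F] q j) := by
    intro a
    rw [← lTensor_algHom_coactOf_apply, hΔ]
    simp [Fintype.sum_prod_type]
  have hε' : ∀ a, ∑ k, f k a ⊗ₜ[F] ε (q k) = a ⊗ₜ[F] (1 : F) := by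
    intro a
    rw [← lTensor_algHom_coactOf_apply, hε]
    simp
  exact ⟨Q, _, bialgebraOfIsUniversalComeasuring hU hΔ' hε', coactOf f q,
    isUniversalCoacting_coactOf hU hΔ' hε'⟩

theorem exists_isUniversalCoacting [FiniteDimensional F A] (𝒜 : OmegaAlgebra F s t A)
    (V : Subalgebra F (Module.End F A)) :
    ∃ (B : Type u) (_ : Ring B) (_ : Bialgebra F B) (ρ : A →ₗ[F] A ⊗[F] B),
      IsUniversalCoacting 𝒜 V ρ := by
  let v := Module.finBasis F (Subalgebra.toSubmodule V)
  obtain ⟨Q, _, _, q, hq⟩ := exists_isUniversalFamily 𝒜 𝒜 (fun k => (v k : A →ₗ[F] A))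
  exact ((isUniversalComeasuring_iff v q).2 hq).exists_isUniversalCoacting fun k => (v k).2

end Coacting

/-! ### Separating tensors by functionals -/

section PairFunctionals

variable {F : Type*} [Field F] {M N : Type*} [AddCommGroup M] [Module F M] [AddCommGroup N]
  [Module F N]

/-- The functional `m ⊗ n ↦ α(m) β(n)`. -/
def tensorDual (α : M →ₗ[F] F) (β : N →ₗ[F] F) : M ⊗[F] N →ₗ[F] F :=
  LinearMap.mul' F F ∘ₗ TensorProduct.map α β

@[simp]
lemma tensorDual_tmul (α : M →ₗ[F] F) (β : N →ₗ[F] F) (m : M) (n : N) :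
    tensorDual α β (m ⊗ₜ n) = α m * β n := by
  simp [tensorDual]

lemma tensorDual_apply_eq_lid (α : M →ₗ[F] F) (β : N →ₗ[F] F) (z : M ⊗[F] N) :
    tensorDual α β z = β (TensorProduct.lid F N (α.rTensor N z)) := by
  induction z with
  | zero => simp
  | add x y hx hy => simp only [map_add, hx, hy]
  | tmul m n => simp

lemma tensorDual_apply_eq_rid (α : M →ₗ[F] F) (β : N →ₗ[F] F) (z : M ⊗[F] N) :
    tensorDual α β z = α (TensorProduct.rid F M (β.lTensor M z)) := by
  induction z with
  | zero => simp
  | add x y hx hy => simp only [map_add, hx, hy]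
  | tmul m n => simp [mul_comm]

/-- A separating family suffices in place of all functionals: in a basis of `N` the coefficients of
the tensor lie in `M`, and applying `f x` to a coefficient is applying a coordinate functional to
the contracted tensor. -/
lemma tensor_ext_separating_left {X : Type*} {f : X → M →ₗ[F] F}
    (hf : ∀ m m', (∀ x, f x m = f x m') → m = m') {y z : M ⊗[F] N}
    (h : ∀ x, TensorProduct.lid F N ((f x).rTensor N y) =
      TensorProduct.lid F N ((f x).rTensor N z)) : y = z := by
  classical
  let C := Module.Basis.ofVectorSpace F N
  refine (TensorProduct.equivFinsuppOfBasisRight C).injective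
    (Finsupp.ext fun i => hf _ _ fun x => ?_)
  rw [TensorProduct.equivFinsuppOfBasisRight_apply, TensorProduct.equivFinsuppOfBasisRight_apply,
    ← tensorDual_apply_eq_rid, ← tensorDual_apply_eq_rid, tensorDual_apply_eq_lid,
    tensorDual_apply_eq_lid, h]

lemma tensor_ext_separating_right {X : Type*} {f : X → N →ₗ[F] F}
    (hf : ∀ n n', (∀ x, f x n = f x n') → n = n') {y z : M ⊗[F] N}
    (h : ∀ x, TensorProduct.rid F M ((f x).lTensor M y) =
      TensorProduct.rid F M ((f x).lTensor M z)) : y = z := by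
  classical
  let C := Module.Basis.ofVectorSpace F M
  refine (TensorProduct.equivFinsuppOfBasisLeft C).injective
    (Finsupp.ext fun i => hf _ _ fun x => ?_)
  rw [TensorProduct.equivFinsuppOfBasisLeft_apply, TensorProduct.equivFinsuppOfBasisLeft_apply,
    ← tensorDual_apply_eq_lid, ← tensorDual_apply_eq_lid, tensorDual_apply_eq_rid,
    tensorDual_apply_eq_rid, h]

lemma tensor_ext_separating {X Y : Type*} {f : X → M →ₗ[F] F} {g : Y → N →ₗ[F] F}
    (hf : ∀ m m', (∀ x, f x m = f x m') → m = m') (hg : ∀ n n', (∀ y, g y n = g y n') → n = n')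
    {z z' : M ⊗[F] N} (h : ∀ x y, tensorDual (f x) (g y) z = tensorDual (f x) (g y) z') :
    z = z' :=
  tensor_ext_separating_left hf fun x => hg _ _ fun y => by
    rw [← tensorDual_apply_eq_lid, ← tensorDual_apply_eq_lid, h]

end PairFunctionals

section General

variable {F : Type*} [Field F]
variable {M N : Type*} [AddCommGroup M] [Module F M] [AddCommGroup N] [Module F N]
  {M' N' : Type*} [AddCommGroup M'] [Module F M'] [AddCommGroup N'] [Module F N']

lemma tensorDual_map (α : M →ₗ[F] F) (β : N →ₗ[F] F) (f : M' →ₗ[F] M) (g : N' →ₗ[F] N)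
    (z : M' ⊗[F] N') :
    tensorDual α β (TensorProduct.map f g z) = tensorDual (α ∘ₗ f) (β ∘ₗ g) z := by
  induction z with
  | zero => simp
  | add x y hx hy => simp only [map_add, hx, hy]
  | tmul m n => simp

lemma tensorDual_assoc (α : M →ₗ[F] F) (β : N →ₗ[F] F) (γ : M' →ₗ[F] F) (z : (M ⊗[F] N) ⊗[F] M') :
    tensorDual α (tensorDual β γ) (TensorProduct.assoc F M N M' z) =
      tensorDual (tensorDual α β) γ z := by
  have : tensorDual α (tensorDual β γ) ∘ₗ (TensorProduct.assoc F M N M').toLinearMap =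
      tensorDual (tensorDual α β) γ := by
    apply TensorProduct.ext_threefold
    intro a b c
    simp [mul_assoc]
  exact LinearMap.congr_fun this z

end General

/-! ### The finite dual coalgebra -/

section FiniteDual

variable (F : Type*) [Field F] (Q : Type*) [Ring Q] [Algebra F Q]

/-- The map `α ↦ (q ↦ α(- q))`. -/
def dualTranslate : Module.Dual F Q →ₗ[F] Q →ₗ[F] Module.Dual F Q where
  toFun α := (LinearMap.mul F Q).flip.compr₂ α
  map_add' α β := by ext; simp
  map_smul' c α := by ext; simp

@[simp]
lemma dualTranslate_apply (α : Module.Dual F Q) (q x : Q) :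
    dualTranslate F Q α q x = α (x * q) := by
  simp [dualTranslate]

/-- The finite dual of the algebra `Q`: the functionals `α` for which the maps `α(- q)` span a
finite dimensional space. -/
def finiteDual : Submodule F (Module.Dual F Q) where
  carrier := {α | FiniteDimensional F (LinearMap.range (dualTranslate F Q α))}
  zero_mem' := by
    change FiniteDimensional F (LinearMap.range (dualTranslate F Q 0))
    rw [map_zero, LinearMap.range_zero]
    infer_instance
  add_mem' {α β} (hα : FiniteDimensional F _) (hβ : FiniteDimensional F _) := by
    change FiniteDimensional F (LinearMap.range (dualTranslate F Q (α + β)))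
    refine Submodule.finiteDimensional_of_le (S₂ := LinearMap.range (dualTranslate F Q α) ⊔
      LinearMap.range (dualTranslate F Q β)) ?_
    rintro _ ⟨q, rfl⟩
    rw [map_add, LinearMap.add_apply]
    exact Submodule.add_mem_sup ⟨q, rfl⟩ ⟨q, rfl⟩
  smul_mem' c α (hα : FiniteDimensional F _) := by
    change FiniteDimensional F (LinearMap.range (dualTranslate F Q (c • α)))
    refine Submodule.finiteDimensional_of_le (S₂ := LinearMap.range (dualTranslate F Q α)) ?_
    rintro _ ⟨q, rfl⟩
    rw [map_smul, LinearMap.smul_apply]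
    exact Submodule.smul_mem _ _ ⟨q, rfl⟩

variable {F Q}

/-- Every translate `α(- q)` equals `∑ hᵢ(q) gᵢ` and so lies in the span of the finitely many `gᵢ`.
-/
lemma mem_finiteDual_of_eq_sum {ι : Type*} (s : Finset ι) {α : Module.Dual F Q}
    (g h : ι → Module.Dual F Q) (hα : ∀ x y, α (x * y) = ∑ i ∈ s, g i x * h i y) :
    α ∈ finiteDual F Q := by
  classical
  change FiniteDimensional F (LinearMap.range (dualTranslate F Q α))
  refine Submodule.finiteDimensional_of_le (S₂ := Submodule.span F (s.image g : Set _)) ?_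
  rintro _ ⟨q, rfl⟩
  have : dualTranslate F Q α q = ∑ i ∈ s, h i q • g i := by
    ext x; simp [hα, mul_comm]
  rw [this]
  exact Submodule.sum_mem _ fun i hi => Submodule.smul_mem _ _
    (Submodule.subset_span (Finset.mem_coe.2 (Finset.mem_image_of_mem g hi)))

/-- The range `W` of `T` is finite dimensional and embeds into the dual of `Y`, so `Y → W*` is
surjective. Hence the coordinate functionals of a basis of `W` are represented by elements `hᵢ` of
`Y`, and the basis vectors are `T(gᵢ)`. -/
lemma exists_sum_of_finiteDimensional_range {X Y M : Type*} [AddCommGroup X] [Module F X]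
    [AddCommGroup Y] [Module F Y] [AddCommGroup M] [Module F M] (T : X →ₗ[F] M)
    (e : M →ₗ[F] Y →ₗ[F] F) (he : Function.Injective e)
    (hT : FiniteDimensional F (LinearMap.range T)) :
    ∃ (n : ℕ) (g : Fin n → X) (h : Fin n → Y), ∀ x, T x = ∑ i, e (T x) (h i) • T (g i) := by
  let b := Module.finBasis F (LinearMap.range T)
  let e' : LinearMap.range T →ₗ[F] Y →ₗ[F] F := e ∘ₗ (LinearMap.range T).subtype
  have hs : Function.Surjective e'.flip :=
    LinearMap.flip_surjective_iff₁.2 (he.comp (LinearMap.range T).injective_subtype)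
  choose h hh using fun i => hs (b.coord i)
  choose g hg using fun i => (b i).2
  refine ⟨_, g, h, fun x => ?_⟩
  have key := congrArg (LinearMap.range T).subtype (b.sum_repr ⟨T x, x, rfl⟩)
  rw [map_sum] at key
  refine key.symm.trans (Finset.sum_congr rfl fun i _ => ?_)
  rw [hg, map_smul, ← Module.Basis.coord_apply, ← hh]
  rfl

/-- Both factors are translates of `α` itself. As translates stay in the finite dual, this puts the
comultiplication of `α` inside the tensor square of the finite dual. -/
lemma exists_sum_of_mem_finiteDual {α : Module.Dual F Q} (hα : α ∈ finiteDual F Q) :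
    ∃ (n : ℕ) (g h : Fin n → Q), ∀ x y,
      α (x * y) = ∑ i, α (x * g i) * α (h i * y) := by
  obtain ⟨n, g, h, e⟩ := exists_sum_of_finiteDimensional_range (M := Module.Dual F Q)
    (dualTranslate F Q α) LinearMap.id Function.injective_id hα
  refine ⟨n, g, h, fun x y => ?_⟩
  simpa [mul_comm] using LinearMap.congr_fun (e y) x

lemma mulRight_mem_finiteDual {α : Module.Dual F Q} (hα : α ∈ finiteDual F Q) (q : Q) :
    α ∘ₗ LinearMap.mulRight F q ∈ finiteDual F Q := by
  obtain ⟨n, g, h, e⟩ := exists_sum_of_mem_finiteDual hα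
  refine mem_finiteDual_of_eq_sum Finset.univ (fun i => α ∘ₗ LinearMap.mulRight F (g i))
    (fun i => α ∘ₗ LinearMap.mulLeft F (h i) ∘ₗ LinearMap.mulRight F q) fun x y => ?_
  simp [mul_assoc x y q, e x (y * q)]

lemma mulLeft_mem_finiteDual {α : Module.Dual F Q} (hα : α ∈ finiteDual F Q) (q : Q) :
    α ∘ₗ LinearMap.mulLeft F q ∈ finiteDual F Q := by
  obtain ⟨n, g, h, e⟩ := exists_sum_of_mem_finiteDual hα
  refine mem_finiteDual_of_eq_sum Finset.univ
    (fun i => α ∘ₗ LinearMap.mulRight F (g i) ∘ₗ LinearMap.mulLeft F q)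
    (fun i => α ∘ₗ LinearMap.mulLeft F (h i)) fun x y => ?_
  simp [← mul_assoc q x y, e (q * x) y]

variable (F Q) in
/-- The underlying space of the finite dual coalgebra of the algebra `Q`. -/
def FiniteDual : Type _ := finiteDual F Q

namespace FiniteDual

instance : AddCommGroup (FiniteDual F Q) := inferInstanceAs (AddCommGroup (finiteDual F Q))

instance : Module F (FiniteDual F Q) := inferInstanceAs (Module F (finiteDual F Q))

variable (F Q) in
/-- The inclusion of the finite dual into the dual. -/
def incl : FiniteDual F Q →ₗ[F] Module.Dual F Q := (finiteDual F Q).subtype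

/-- An element of the finite dual. -/
def mk (α : Module.Dual F Q) (hα : α ∈ finiteDual F Q) : FiniteDual F Q := ⟨α, hα⟩

@[simp]
lemma incl_mk (α : Module.Dual F Q) (hα : α ∈ finiteDual F Q) : incl F Q (mk α hα) = α := rfl

lemma incl_mem (α : FiniteDual F Q) : incl F Q α ∈ finiteDual F Q := Subtype.property α

/-- Evaluation at `x`. -/
def ev (x : Q) : FiniteDual F Q →ₗ[F] F := (incl F Q).flip x

@[simp]
lemma ev_apply (x : Q) (α : FiniteDual F Q) : ev x α = incl F Q α x := rfl

/-- A linear map into the dual with values in the finite dual, as a map into the finite dual. -/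
def codRestrict {P : Type*} [AddCommGroup P] [Module F P] (g : P →ₗ[F] Module.Dual F Q)
    (hg : ∀ p, g p ∈ finiteDual F Q) : P →ₗ[F] FiniteDual F Q :=
  LinearMap.codRestrict (finiteDual F Q) g hg

lemma ext_ev (α β : FiniteDual F Q) (h : ∀ x, ev x α = ev x β) : α = β :=
  Subtype.ext (LinearMap.ext h)

/-- Indexing by pairs makes this a separating family of the form that `tensor_ext_separating` takes,
so it can be used again on triple tensors. -/
lemma ext_ev₂ (z z' : FiniteDual F Q ⊗[F] FiniteDual F Q)
    (h : ∀ p : Q × Q, tensorDual (ev p.1) (ev p.2) z = tensorDual (ev p.1) (ev p.2) z') : z = z' :=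
  tensor_ext_separating ext_ev ext_ev fun x y => h (x, y)

lemma exists_comul (α : FiniteDual F Q) : ∃ z : FiniteDual F Q ⊗[F] FiniteDual F Q,
    ∀ x y, tensorDual (ev x) (ev y) z = ev (x * y) α := by
  obtain ⟨n, g, h, e⟩ := exists_sum_of_mem_finiteDual α.incl_mem
  refine ⟨∑ i, mk _ (mulRight_mem_finiteDual α.incl_mem (g i)) ⊗ₜ
    mk _ (mulLeft_mem_finiteDual α.incl_mem (h i)), fun x y => ?_⟩
  rw [ev_apply, e x y]
  simp

/-- The comultiplication of the finite dual. -/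
def comulMap : FiniteDual F Q →ₗ[F] FiniteDual F Q ⊗[F] FiniteDual F Q where
  toFun α := (exists_comul α).choose
  -- The chosen tensor is determined by its evaluations, which are linear in `α`.
  map_add' α β := ext_ev₂ _ _ fun p => by
    rw [map_add, (exists_comul _).choose_spec, (exists_comul _).choose_spec,
      (exists_comul _).choose_spec, map_add]
  map_smul' c α := ext_ev₂ _ _ fun p => by
    rw [RingHom.id_apply, map_smul, (exists_comul _).choose_spec, (exists_comul _).choose_spec,
      map_smul]

lemma tensorDual_comulMap (x y : Q) :
    tensorDual (ev x) (ev y) ∘ₗ comulMap (F := F) (Q := Q) = ev (x * y) :=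
  LinearMap.ext fun α => (exists_comul α).choose_spec x y

/-- After evaluation, the coalgebra axioms are the associativity and unit laws of `Q`. -/
instance : Coalgebra F (FiniteDual F Q) where
  comul := comulMap
  counit := ev 1
  coassoc := by
    ext1 α
    refine tensor_ext_separating (ext_ev) ext_ev₂ fun x p => ?_
    simp only [LinearMap.comp_apply, LinearEquiv.coe_coe]
    rw [tensorDual_assoc, LinearMap.rTensor, LinearMap.lTensor, tensorDual_map, tensorDual_map,
      tensorDual_comulMap, tensorDual_comulMap, LinearMap.comp_id, LinearMap.comp_id,
      ← LinearMap.comp_apply, ← LinearMap.comp_apply, tensorDual_comulMap, tensorDual_comulMap,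
      mul_assoc]
  rTensor_counit_comp_comul := by
    ext1 α
    refine (TensorProduct.lid F _).injective (ext_ev _ _ fun y => ?_)
    rw [LinearMap.comp_apply, ← tensorDual_apply_eq_lid, ← LinearMap.comp_apply,
      tensorDual_comulMap, one_mul]
    simp
  lTensor_counit_comp_comul := by
    ext1 α
    refine (TensorProduct.rid F _).injective (ext_ev _ _ fun y => ?_)
    rw [LinearMap.comp_apply, ← tensorDual_apply_eq_rid, ← LinearMap.comp_apply,
      tensorDual_comulMap, mul_one]
    simp

lemma tensorDual_comul (x y : Q) (α : FiniteDual F Q) :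
    tensorDual (ev x) (ev y) (Coalgebra.comul (R := F) α) = ev (x * y) α :=
  LinearMap.congr_fun (tensorDual_comulMap x y) α

end FiniteDual

end FiniteDual

/-- A pairing between a coalgebra `P` and an algebra `Q`, turning the multiplication and the unit of
`Q` into the comultiplication and the counit of `P`. -/
structure IsPairing {F : Type*} [Field F] {P : Type*} [AddCommGroup P] [Module F P] [Coalgebra F P]
    {Q : Type*} [Ring Q] [Algebra F Q] (g : P →ₗ[F] Module.Dual F Q) : Prop where
  apply_one : ∀ p, g p 1 = Coalgebra.counit (R := F) p
  apply_mul : ∀ p x y,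
    g p (x * y) = tensorDual (g.flip x) (g.flip y) (Coalgebra.comul (R := F) p)

/-! ### Pairings as coalgebra maps into `Q°` and as algebra maps into `P*` -/

section Pairings

variable {F : Type*} [Field F] {P : Type*} [AddCommGroup P] [Module F P] [Coalgebra F P]
  {Q : Type*} [Ring Q] [Algebra F Q] {g : P →ₗ[F] Module.Dual F Q}

lemma isPairing_comp_coalgHom (φ : P →ₗc[F] FiniteDual F Q) :
    IsPairing (FiniteDual.incl F Q ∘ₗ φ.toLinearMap) where
  apply_one p := by
    have := LinearMap.congr_fun φ.counit_comp p
    exact this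
  apply_mul p x y := by
    have := LinearMap.congr_fun φ.map_comp_comul p
    have h := FiniteDual.tensorDual_comul x y (φ p)
    rw [LinearMap.comp_apply, LinearMap.comp_apply] at this
    change tensorDual _ _ (Coalgebra.comul (R := F) (φ.toLinearMap p)) = _ at h
    rw [← this, tensorDual_map] at h
    exact h.symm

lemma isPairing_subtype : IsPairing (FiniteDual.incl F Q) where
  apply_one _ := rfl
  apply_mul p x y := (FiniteDual.tensorDual_comul x y p).symm

lemma IsPairing.mem_finiteDual (hg : IsPairing g) (p : P) : g p ∈ finiteDual F Q := by
  let r := Coalgebra.Repr.arbitrary F p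
  refine mem_finiteDual_of_eq_sum r.index (fun i => g (r.left i)) (fun i => g (r.right i))
    fun x y => ?_
  rw [hg.apply_mul, ← r.eq]
  simp

/-- The coalgebra homomorphism into the finite dual given by a pairing. -/
def IsPairing.toCoalgHom (hg : IsPairing g) : P →ₗc[F] FiniteDual F Q where
  toLinearMap := FiniteDual.codRestrict g hg.mem_finiteDual
  counit_comp := by
    ext p
    exact hg.apply_one p
  map_comp_comul := by
    ext p
    refine FiniteDual.ext_ev₂ _ _ fun z => ?_
    rw [LinearMap.comp_apply, LinearMap.comp_apply, tensorDual_map, FiniteDual.tensorDual_comul]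
    exact (hg.apply_mul p _ _).symm

/-- The algebra homomorphism into the convolution algebra given by a pairing. -/
def IsPairing.toAlgHom (hg : IsPairing g) : Q →ₐ[F] WithConv (P →ₗ[F] F) :=
  AlgHom.ofLinearMap ((WithConv.linearEquiv F (P →ₗ[F] F)).symm.toLinearMap ∘ₗ g.flip)
    (by ext p; simpa using hg.apply_one p)
    (fun x y => by ext p; simpa [tensorDual] using hg.apply_mul p x y)

lemma isPairing_of_algHom (φ : Q →ₐ[F] WithConv (P →ₗ[F] F)) :
    IsPairing ((WithConv.linearEquiv F (P →ₗ[F] F)).toLinearMap ∘ₗ φ.toLinearMap).flip where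
  apply_one p := by simp
  apply_mul p x y := by simp [tensorDual]

end Pairings

/-! ### Measurings as finite families of coefficients -/

section ActOf

variable {F : Type*} [Field F] {P : Type*} [AddCommGroup P] [Module F P]
  {Q : Type*} [Ring Q] [Algebra F Q]
  {A : Type*} [AddCommGroup A] [Module F A] {B : Type*} [AddCommGroup B] [Module F B]
  {K : Type*} [Fintype K]

/-- The map `p ↦ ∑ₖ ⟨p, qₖ⟩ fₖ`. -/
def actOf (g : P →ₗ[F] Module.Dual F Q) (f : K → A →ₗ[F] B) (q : K → Q) : P →ₗ[F] A →ₗ[F] B :=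
  ∑ k, (g.flip (q k)).smulRight (f k)

@[simp]
lemma actOf_apply (g : P →ₗ[F] Module.Dual F Q) (f : K → A →ₗ[F] B) (q : K → Q) (p : P) :
    actOf g f q p = ∑ k, g p (q k) • f k := by
  simp [actOf]

lemma piTensorHomMap_map_actOf (g : P →ₗ[F] Module.Dual F Q) (f : K → A →ₗ[F] B) (q : K → Q) {n : ℕ}
    (z : ⨂[F]^n P) (x : ⨂[F]^n A) :
    PiTensorProduct.piTensorHomMap (PiTensorProduct.map (fun _ => actOf g f q) z) x =
      ∑ k : Fin n → K, PiTensorProduct.dualDistrib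
        (PiTensorProduct.tprod F fun i => g.flip (q (k i))) z •
          PiTensorProduct.map (fun i => f (k i)) x := by
  classical
  induction z using PiTensorProduct.induction_on with
  | add z z' hz hz' =>
    simp only [map_add, LinearMap.add_apply, hz, hz', add_smul, Finset.sum_add_distrib]
  | smul_tprod r z =>
    induction x using PiTensorProduct.induction_on with
    | add x x' hx hx' => simp only [map_add, smul_add, hx, hx', Finset.sum_add_distrib]
    | smul_tprod c x =>
      simp only [map_smul, LinearMap.smul_apply, PiTensorProduct.map_tprod, smul_assoc,
        PiTensorProduct.piTensorHomMap_tprod_tprod, PiTensorProduct.dualDistrib_apply,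
        ← Finset.smul_sum, smul_comm _ c]
      congr 2
      simp only [actOf_apply, LinearMap.sum_apply, LinearMap.smul_apply]
      rw [MultilinearMap.map_sum]
      refine Finset.sum_congr rfl fun k _ => ?_
      rw [MultilinearMap.map_smul_univ]
      simp

end ActOf

section MeasPow

variable {F : Type*} [Field F] {P : Type*} [AddCommGroup P] [Module F P] [Coalgebra F P]
  {Q : Type*} [Ring Q] [Algebra F Q] {g : P →ₗ[F] Module.Dual F Q}

lemma dualDistrib_mulEquiv {M : Type*} [AddCommGroup M] [Module F M] {n : ℕ}
    (φ : Fin (n + 1) → Module.Dual F M) (z : (⨂[F]^n M) ⊗[F] M) :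
    PiTensorProduct.dualDistrib (PiTensorProduct.tprod F φ)
      (TensorPower.mulEquiv (R := F) (M := M) (n := n) (m := 1)
        (TensorProduct.map LinearMap.id
          (PiTensorProduct.subsingletonEquiv (R := F) (s := fun _ => M) (0 : Fin 1)).symm.toLinearMap z)) =
      tensorDual (PiTensorProduct.dualDistrib (PiTensorProduct.tprod F fun i : Fin n => φ i.castSucc))
        (φ (Fin.last n)) z := by
  induction z with
  | zero => simp
  | add x y hx hy => simp only [map_add, hx, hy]
  | tmul x b =>
    induction x using PiTensorProduct.induction_on with
    | add x y hx hy => simp only [TensorProduct.add_tmul, map_add, hx, hy]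
    | smul_tprod r a =>
      simp only [← TensorProduct.smul_tmul', map_smul]
      congr 1
      rw [TensorProduct.map_tmul, LinearMap.id_apply, LinearEquiv.coe_coe,
        mulEquiv_tmul_subsingletonEquiv_symm, PiTensorProduct.dualDistrib_apply, tensorDual_tmul,
        PiTensorProduct.dualDistrib_apply, Fin.prod_univ_castSucc]
      simp

/-- The iterated comultiplication of `P` is dual to the `n`-fold product of `Q`; both recursions
split off the last factor. -/
lemma IsPairing.dualDistrib_comulPow (hg : IsPairing g) {n : ℕ} (y : Fin n → Q) (p : P) :
    PiTensorProduct.dualDistrib (PiTensorProduct.tprod F fun i => g.flip (y i)) (comulPow F P n p) =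
      g p (List.ofFn y).prod := by
  induction n generalizing p with
  | zero =>
    simp only [comulPow, LinearMap.comp_apply, LinearEquiv.coe_coe, algebraMap₀_apply, map_smul,
      PiTensorProduct.dualDistrib_apply]
    simp [hg.apply_one]
  | succ n ih =>
    have h1 : TensorProduct.map (comulPow F P n)
        (PiTensorProduct.subsingletonEquiv (R := F) (s := fun _ => P) (0 : Fin 1)).symm.toLinearMap =
        TensorProduct.map LinearMap.id
        (PiTensorProduct.subsingletonEquiv (R := F) (s := fun _ => P) (0 : Fin 1)).symm.toLinearMap ∘ₗ
        TensorProduct.map (comulPow F P n) LinearMap.id := by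
      rw [← TensorProduct.map_comp, LinearMap.id_comp, LinearMap.comp_id]
    have h2 : PiTensorProduct.dualDistrib (PiTensorProduct.tprod F fun i : Fin n =>
        g.flip (y i.castSucc)) ∘ₗ comulPow F P n =
        g.flip (List.ofFn fun i : Fin n => y i.castSucc).prod :=
      LinearMap.ext fun p => ih (fun i => y i.castSucc) p
    rw [comulPow, h1, LinearMap.comp_apply, LinearMap.comp_apply, LinearMap.comp_apply,
      LinearEquiv.coe_coe, dualDistrib_mulEquiv, tensorDual_map, LinearMap.comp_id, h2,
      ← hg.apply_mul, List.ofFn_succ']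
    simp

variable {A : Type*} [AddCommGroup A] [Module F A] {B : Type*} [AddCommGroup B] [Module F B]
  {K : Type*} [Fintype K]

/-- Contracting the comeasuring identity with `g p` gives the measuring identity at `p`; the
converse holds when the functionals `g p` separate the points of `Q`. -/
lemma IsPairing.measPow_actOf (hg : IsPairing g) (f : K → A →ₗ[F] B) (q : K → Q) (n : ℕ) (p : P)
    (x : ⨂[F]^n A) :
    measPow (actOf g f q) n p x =
      TensorProduct.rid F _ ((g p).lTensor _ (comeasPow (coactOf f q) n x)) := by
  rw [measPow, LinearMap.comp_apply, LinearMap.comp_apply, piTensorHomMap_map_actOf,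
    comeasPow_coactOf]
  simp [hg.dualDistrib_comulPow]

variable {Ω : Type*} {s t : Ω → ℕ} {𝒜 : OmegaAlgebra F s t A} {ℬ : OmegaAlgebra F s t B}

lemma rid_lTensor_rTensor {M N : Type*} [AddCommGroup M] [Module F M] [AddCommGroup N] [Module F N]
    (α : Module.Dual F Q) (h : M →ₗ[F] N) (z : M ⊗[F] Q) :
    TensorProduct.rid F N (α.lTensor N (h.rTensor Q z)) =
      h (TensorProduct.rid F M (α.lTensor M z)) := by
  induction z with
  | zero => simp
  | add x y hx hy => simp only [map_add, hx, hy]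
  | tmul m n => simp

lemma IsPairing.isMeasuring_actOf (hg : IsPairing g) {f : K → A →ₗ[F] B} {q : K → Q}
    (h : IsComeasuring 𝒜 ℬ (coactOf f q)) : IsMeasuring 𝒜 ℬ (actOf g f q) := by
  intro ω p x
  rw [hg.measPow_actOf, hg.measPow_actOf, h, rid_lTensor_rTensor]

lemma IsPairing.isComeasuring_coactOf (hg : IsPairing g)
    (hsep : ∀ x y, (∀ p, g p x = g p y) → x = y) {f : K → A →ₗ[F] B} {q : K → Q}
    (h : IsMeasuring 𝒜 ℬ (actOf g f q)) : IsComeasuring 𝒜 ℬ (coactOf f q) := by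
  intro ω x
  refine tensor_ext_separating_right hsep fun p => ?_
  rw [rid_lTensor_rTensor, ← hg.measPow_actOf, ← hg.measPow_actOf, h]

variable (F P) in
/-- The evaluation pairing between a coalgebra and its dual algebra. -/
def convPairing : P →ₗ[F] Module.Dual F (WithConv (P →ₗ[F] F)) :=
  ((WithConv.linearEquiv F (P →ₗ[F] F)).toLinearMap ∘ₗ
      (AlgHom.id F (WithConv (P →ₗ[F] F))).toLinearMap).flip

lemma isPairing_convPairing : IsPairing (convPairing F P) := isPairing_of_algHom _

/-- The `k`-th coefficient is the functional on `P` sending `p` to the `k`-th coordinate of `ψ p`.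
-/
lemma exists_eq_actOf {K : Type*} [Fintype K] {V : Submodule F (A →ₗ[F] B)}
    (v : Module.Basis K F V) {ψ : P →ₗ[F] A →ₗ[F] B} (hV : LinearMap.range ψ ≤ V) :
    ∃ q : K → WithConv (P →ₗ[F] F),
      ψ = actOf (convPairing F P) (fun k => (v k : A →ₗ[F] B)) q := by
  let ψ' : P →ₗ[F] V := ψ.codRestrict V fun p => hV ⟨p, rfl⟩
  refine ⟨fun k => WithConv.toConv (v.coord k ∘ₗ ψ'), LinearMap.ext fun p => ?_⟩
  have := congrArg V.subtype (v.sum_repr (ψ' p))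
  rw [map_sum] at this
  rw [actOf_apply]
  exact this.symm

lemma isMeasuring_actOf_convPairing_iff {K : Type*} [Fintype K] {f : K → A →ₗ[F] B}
    {q : K → WithConv (P →ₗ[F] F)} :
    IsMeasuring 𝒜 ℬ (actOf (convPairing F P) f q) ↔ IsComeasuring 𝒜 ℬ (coactOf f q) :=
  ⟨isPairing_convPairing.isComeasuring_coactOf fun _ _ hxy => WithConv.ext (LinearMap.ext hxy),
    isPairing_convPairing.isMeasuring_actOf⟩

end MeasPow

/-! ### The universal measuring coalgebra -/

section Universal

variable {F : Type u} [Field F] {Ω : Type w} {s t : Ω → ℕ}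
  {A : Type u} [AddCommGroup A] [Module F A] {B : Type u} [AddCommGroup B] [Module F B]
  {𝒜 : OmegaAlgebra F s t A} {ℬ : OmegaAlgebra F s t B} {K : Type*} [Fintype K]

/-- A measuring by `P` with cosupport in `V` is a comeasuring family in `P*`, hence an algebra
homomorphism `Q → P*`, hence a pairing, hence a coalgebra homomorphism from `P` to the finite dual
of `Q`. -/
theorem IsUniversalFamily.isUniversalMeasuring {V : Submodule F (A →ₗ[F] B)}
    (v : Module.Basis K F V) {Q : Type u} [Ring Q] [Algebra F Q] {q : K → Q}
    (h : IsUniversalFamily 𝒜 ℬ (fun k => (v k : A →ₗ[F] B)) q) :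
    IsUniversalMeasuring 𝒜 ℬ V
      (actOf (FiniteDual.incl F Q) (fun k => (v k : A →ₗ[F] B)) q) := by
  have hv := linearIndependent_coe_basis v
  refine ⟨isPairing_subtype.isMeasuring_actOf h.isComeasuring, ?_, ?_⟩
  · rintro _ ⟨p, rfl⟩
    rw [actOf_apply]
    exact V.sum_mem fun k _ => V.smul_mem _ (v k).2
  · intro P _ _ _ ψ hψ hV
    obtain ⟨q', rfl⟩ := exists_eq_actOf v hV
    have hq' := isMeasuring_actOf_convPairing_iff.1 hψ
    obtain ⟨φ, hφ, huniq⟩ := h.initial q' hq'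
    refine ⟨(isPairing_of_algHom φ).toCoalgHom, ?_, fun χ hχ => ?_⟩
    · dsimp only
      ext1 p
      rw [LinearMap.comp_apply, actOf_apply, actOf_apply]
      refine Finset.sum_congr rfl fun k _ => ?_
      rw [← hφ]
      rfl
    -- Uniqueness runs the correspondence backwards: independence of `v` recovers the values on the
    -- generators `q k`.
    · have hχ' : (isPairing_comp_coalgHom χ).toAlgHom = φ := by
        refine huniq _ fun k => WithConv.ext (LinearMap.ext fun p => ?_)
        have h1 := LinearMap.congr_fun hχ p
        rw [LinearMap.comp_apply, actOf_apply, actOf_apply] at h1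
        exact hv.eq_coords_of_eq h1 k
      ext p
      refine FiniteDual.ext_ev _ _ fun x => ?_
      exact LinearMap.congr_fun (congrArg WithConv.ofConv (AlgHom.congr_fun hχ' x)) p

theorem exists_isUniversalMeasuring [FiniteDimensional F A] [FiniteDimensional F B]
    (𝒜 : OmegaAlgebra F s t A) (ℬ : OmegaAlgebra F s t B) (V : Submodule F (A →ₗ[F] B)) :
    ∃ (P : Type u) (_ : AddCommGroup P) (_ : Module F P) (_ : Coalgebra F P)
      (ψ : P →ₗ[F] A →ₗ[F] B), IsUniversalMeasuring 𝒜 ℬ V ψ := by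
  let v := Module.finBasis F V
  obtain ⟨Q, _, _, q, hq⟩ := exists_isUniversalFamily 𝒜 ℬ (fun k => (v k : A →ₗ[F] B))
  exact ⟨_, _, _, _, _, hq.isUniversalMeasuring v⟩

end Universal

/-! ### Composition of measurings -/

section TensorMaps

variable {F : Type*} [Field F] {P : Type*} [AddCommGroup P] [Module F P]
  {P' : Type*} [AddCommGroup P'] [Module F P']
  {Q : Type*} [Ring Q] [Algebra F Q] {Q' : Type*} [Ring Q'] [Algebra F Q']
  {A : Type*} [AddCommGroup A] [Module F A] {B : Type*} [AddCommGroup B] [Module F B]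
  {C : Type*} [AddCommGroup C] [Module F C]

/-- The pairing of tensor products `⟨p ⊗ p', x ⊗ x'⟩ = ⟨p, x⟩ ⟨p', x'⟩`. -/
def tensorPairing (g : P →ₗ[F] Module.Dual F Q) (g' : P' →ₗ[F] Module.Dual F Q') :
    P ⊗[F] P' →ₗ[F] Module.Dual F (Q ⊗[F] Q') :=
  TensorProduct.dualDistrib F Q Q' ∘ₗ TensorProduct.map g g'

@[simp]
lemma tensorPairing_tmul_tmul (g : P →ₗ[F] Module.Dual F Q) (g' : P' →ₗ[F] Module.Dual F Q')
    (p : P) (p' : P') (x : Q) (x' : Q') :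
    tensorPairing g g' (p ⊗ₜ p') (x ⊗ₜ x') = g p x * g' p' x' := by
  simp [tensorPairing]

/-- The composition of measurings, `p ⊗ p' ↦ ψ(p) ∘ ψ'(p')`. -/
def compMeas (ψ : P →ₗ[F] B →ₗ[F] C) (ψ' : P' →ₗ[F] A →ₗ[F] B) : P ⊗[F] P' →ₗ[F] A →ₗ[F] C :=
  TensorProduct.lift ((LinearMap.llcomp F A B C).compl₁₂ ψ ψ')

@[simp]
lemma compMeas_tmul (ψ : P →ₗ[F] B →ₗ[F] C) (ψ' : P' →ₗ[F] A →ₗ[F] B) (p : P) (p' : P') :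
    compMeas ψ ψ' (p ⊗ₜ p') = ψ p ∘ₗ ψ' p' := by
  ext; simp [compMeas]

end TensorMaps

section Pairings

variable {F : Type*} [Field F] {P : Type*} [AddCommGroup P] [Module F P] [Coalgebra F P]
  {P' : Type*} [AddCommGroup P'] [Module F P'] [Coalgebra F P']
  {Q : Type*} [Ring Q] [Algebra F Q] {Q' : Type*} [Ring Q'] [Algebra F Q']
  {g : P →ₗ[F] Module.Dual F Q} {g' : P' →ₗ[F] Module.Dual F Q'}

lemma IsPairing.comp_coalgHom (hg : IsPairing g) (φ : P' →ₗc[F] P) :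
    IsPairing (g ∘ₗ φ.toLinearMap) where
  apply_one p := (hg.apply_one _).trans (LinearMap.congr_fun φ.counit_comp p)
  apply_mul p x y := by
    have := LinearMap.congr_fun φ.map_comp_comul p
    rw [LinearMap.comp_apply, LinearMap.comp_apply] at this
    rw [LinearMap.comp_apply, hg.apply_mul, ← this, tensorDual_map]
    rfl

lemma isPairing_mul : IsPairing (LinearMap.mul F F : F →ₗ[F] Module.Dual F F) where
  apply_one p := by simp
  apply_mul p x y := by simp; ring

lemma tensorDual_tensorTensorTensorComm {M N M' N' : Type*} [AddCommGroup M] [Module F M]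
    [AddCommGroup N] [Module F N] [AddCommGroup M'] [Module F M'] [AddCommGroup N'] [Module F N']
    {α : M ⊗[F] M' →ₗ[F] F} {β : N ⊗[F] N' →ₗ[F] F} {α₁ : M →ₗ[F] F} {α₂ : M' →ₗ[F] F}
    {β₁ : N →ₗ[F] F} {β₂ : N' →ₗ[F] F} (hα : ∀ m m', α (m ⊗ₜ m') = α₁ m * α₂ m')
    (hβ : ∀ n n', β (n ⊗ₜ n') = β₁ n * β₂ n') (z : M ⊗[F] N) (z' : M' ⊗[F] N') :
    tensorDual α β (TensorProduct.tensorTensorTensorComm F M N M' N' (z ⊗ₜ z')) =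
      tensorDual α₁ β₁ z * tensorDual α₂ β₂ z' := by
  induction z with
  | zero => simp
  | add x y hx hy => simp only [TensorProduct.add_tmul, map_add, add_mul, hx, hy]
  | tmul m n =>
    induction z' with
    | zero => simp
    | add x y hx hy => simp only [TensorProduct.tmul_add, map_add, mul_add, hx, hy]
    | tmul m' n' =>
      simp only [TensorProduct.tensorTensorTensorComm_tmul, tensorDual_tmul, hα, hβ]
      ring

/-- The comultiplication of `P ⊗ P'` and the multiplication of `Q ⊗ Q'` involve the same interchange
of the two middle factors. -/
lemma IsPairing.tensor (hg : IsPairing g) (hg' : IsPairing g') :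
    IsPairing (tensorPairing g g') where
  apply_one z := by
    induction z with
    | zero => simp
    | add z z' hz hz' => simp only [map_add, LinearMap.add_apply, hz, hz']
    | tmul p p' => simp [Algebra.TensorProduct.one_def, hg.apply_one, hg'.apply_one, mul_comm]
  apply_mul z X Y := by
    induction z with
    | zero => simp
    | add z z' hz hz' => simp only [map_add, LinearMap.add_apply, hz, hz']
    | tmul p p' =>
      have hadd : ∀ X₁ X₂ : P ⊗[F] P' →ₗ[F] F, ∀ Y₁ Y₂ : P ⊗[F] P' →ₗ[F] F, ∀ z,
          tensorDual (X₁ + X₂) Y₁ z = tensorDual X₁ Y₁ z + tensorDual X₂ Y₁ z ∧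
          tensorDual X₁ (Y₁ + Y₂) z = tensorDual X₁ Y₁ z + tensorDual X₁ Y₂ z := by
        intro X₁ X₂ Y₁ Y₂ z
        simp [tensorDual, TensorProduct.map_add_left, TensorProduct.map_add_right]
      induction X with
      | zero => simp [tensorDual]
      | add X X' hX hX' => rw [add_mul, map_add, map_add, (hadd _ _ _ 0 _).1, hX, hX']
      | tmul x x' =>
        induction Y with
        | zero => simp [tensorDual]
        | add Y Y' hY hY' => rw [mul_add, map_add, map_add, (hadd _ 0 _ _ _).2, hY, hY']
        | tmul y y' =>
          rw [Algebra.TensorProduct.tmul_mul_tmul, tensorPairing_tmul_tmul, hg.apply_mul,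
            hg'.apply_mul, TensorProduct.comul_tmul]
          exact (tensorDual_tensorTensorTensorComm
            (fun _ _ => by simp) (fun _ _ => by simp) _ _).symm

variable {Ω : Type*} {s t : Ω → ℕ}
  {A : Type*} [AddCommGroup A] [Module F A] {B : Type*} [AddCommGroup B] [Module F B]
  {C : Type*} [AddCommGroup C] [Module F C]
  {𝒜 : OmegaAlgebra F s t A} {ℬ : OmegaAlgebra F s t B} {𝒞 : OmegaAlgebra F s t C}

lemma IsMeasuring.exists_eq_actOf [FiniteDimensional F A] [FiniteDimensional F B]
    {ψ : P →ₗ[F] A →ₗ[F] B} (h : IsMeasuring 𝒜 ℬ ψ) :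
    ∃ (n : ℕ) (f : Fin n → A →ₗ[F] B) (q : Fin n → WithConv (P →ₗ[F] F)),
      IsComeasuring 𝒜 ℬ (coactOf f q) ∧ ψ = actOf (convPairing F P) f q := by
  obtain ⟨q, rfl⟩ := _root_.exists_eq_actOf (Module.finBasis F (⊤ : Submodule F (A →ₗ[F] B)))
    (ψ := ψ) le_top
  exact ⟨_, _, q, isMeasuring_actOf_convPairing_iff.1 h, rfl⟩

lemma IsMeasuring.comp_coalgHom [FiniteDimensional F A] [FiniteDimensional F B]
    {ψ : P →ₗ[F] A →ₗ[F] B} (h : IsMeasuring 𝒜 ℬ ψ) (φ : P' →ₗc[F] P) :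
    IsMeasuring 𝒜 ℬ (ψ ∘ₗ φ.toLinearMap) := by
  obtain ⟨n, f, q, hq, rfl⟩ := h.exists_eq_actOf
  have : actOf (convPairing F P) f q ∘ₗ φ.toLinearMap =
      actOf (convPairing F P ∘ₗ φ.toLinearMap) f q := by
    ext1 p; simp
  rw [this]
  exact (isPairing_convPairing.comp_coalgHom φ).isMeasuring_actOf hq

/-- The composite comes from the composed comeasuring over `P* ⊗ P'*`, through its pairing with `P ⊗
P'`. -/
lemma IsMeasuring.compMeas [FiniteDimensional F A] [FiniteDimensional F B] [FiniteDimensional F C]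
    {ψ : P →ₗ[F] B →ₗ[F] C} {ψ' : P' →ₗ[F] A →ₗ[F] B} (h : IsMeasuring ℬ 𝒞 ψ)
    (h' : IsMeasuring 𝒜 ℬ ψ') : IsMeasuring 𝒜 𝒞 (compMeas ψ ψ') := by
  obtain ⟨n, f, q, hq, rfl⟩ := h.exists_eq_actOf
  obtain ⟨n', f', q', hq', rfl⟩ := h'.exists_eq_actOf
  have : _root_.compMeas (actOf (convPairing F P) f q) (actOf (convPairing F P') f' q') =
      actOf (tensorPairing (convPairing F P) (convPairing F P'))
        (fun p : Fin n × Fin n' => f p.1 ∘ₗ f' p.2) (fun p => q p.1 ⊗ₜ[F] q' p.2) := by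
    refine TensorProduct.ext' fun p p' => ?_
    ext a
    simp [Fintype.sum_prod_type, Finset.smul_sum, smul_smul]
  rw [this]
  exact (isPairing_convPairing.tensor isPairing_convPairing).isMeasuring_actOf
    (isComeasuring_coactOf_comp hq hq')

lemma isMeasuring_id : IsMeasuring 𝒜 𝒜 (LinearMap.toSpanSingleton F (A →ₗ[F] A) LinearMap.id) := by
  have : LinearMap.toSpanSingleton F (A →ₗ[F] A) LinearMap.id =
      actOf (LinearMap.mul F F : F →ₗ[F] Module.Dual F F)
        (fun _ : Unit => (LinearMap.id : A →ₗ[F] A)) (fun _ => (1 : F)) := by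
    ext; simp
  rw [this]
  exact isPairing_mul.isMeasuring_actOf isComeasuring_coactOf_id

end Pairings

/-! ### The universal acting bialgebra -/

section Acting

variable {F : Type u} [Field F] {Ω : Type w} {s t : Ω → ℕ}
  {A : Type u} [AddCommGroup A] [Module F A] {B : Type u} [AddCommGroup B] [Module F B]
  {P : Type u} [AddCommGroup P] [Module F P] [Coalgebra F P]

lemma IsUniversalMeasuring.hom_ext [FiniteDimensional F A] [FiniteDimensional F B]
    {𝒜 : OmegaAlgebra F s t A} {ℬ : OmegaAlgebra F s t B} {V : Submodule F (A →ₗ[F] B)}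
    {ψ : P →ₗ[F] A →ₗ[F] B} (h : IsUniversalMeasuring 𝒜 ℬ V ψ)
    {P' : Type u} [AddCommGroup P'] [Module F P'] [Coalgebra F P'] {φ φ' : P' →ₗc[F] P}
    (hφ : ψ ∘ₗ φ.toLinearMap = ψ ∘ₗ φ'.toLinearMap) : φ = φ' :=
  (h.terminal _ (h.isMeasuring.comp_coalgHom φ')
    ((LinearMap.range_comp_le_range _ _).trans h.cosupp_le)).unique hφ rfl

/-- The ring structure given by an associative unital multiplication `P ⊗ P → P`. -/
abbrev ringOfTensorMul (m : P ⊗[F] P →ₗ[F] P) (e : P)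
    (hassoc : ∀ a b c, m (m (a ⊗ₜ b) ⊗ₜ c) = m (a ⊗ₜ m (b ⊗ₜ c)))
    (hone : ∀ a, m (e ⊗ₜ a) = a) (hone' : ∀ a, m (a ⊗ₜ e) = a) : Ring P where
  __ := ‹AddCommGroup P›
  mul a b := m (a ⊗ₜ b)
  one := e
  left_distrib a b c := by change m _ = m _ + m _; rw [TensorProduct.tmul_add, map_add]
  right_distrib a b c := by change m _ = m _ + m _; rw [TensorProduct.add_tmul, map_add]
  zero_mul a := by change m _ = 0; rw [TensorProduct.zero_tmul, map_zero]
  mul_zero a := by change m _ = 0; rw [TensorProduct.tmul_zero, map_zero]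
  mul_assoc := hassoc
  one_mul := hone
  mul_one := hone'
  zsmul := (inferInstance : AddCommGroup P).zsmul
  zsmul_zero' := (inferInstance : AddCommGroup P).zsmul_zero'
  zsmul_succ' := (inferInstance : AddCommGroup P).zsmul_succ'
  zsmul_neg' := (inferInstance : AddCommGroup P).zsmul_neg'
  neg_add_cancel := neg_add_cancel

/-- The algebra structure given by an associative unital multiplication `P ⊗ P → P`. -/
abbrev algebraOfTensorMul (m : P ⊗[F] P →ₗ[F] P) (e : P)
    (hassoc : ∀ a b c, m (m (a ⊗ₜ b) ⊗ₜ c) = m (a ⊗ₜ m (b ⊗ₜ c)))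
    (hone : ∀ a, m (e ⊗ₜ a) = a) (hone' : ∀ a, m (a ⊗ₜ e) = a) :
    letI := ringOfTensorMul m e hassoc hone hone'
    Algebra F P :=
  letI := ringOfTensorMul m e hassoc hone hone'
  Algebra.ofModule
    (fun r x y => by change m _ = r • m _; rw [← TensorProduct.smul_tmul', map_smul])
    (fun r x y => by change m _ = r • m _; rw [TensorProduct.tmul_smul, map_smul])

/-- The bialgebra structure given by an associative unital multiplication `P ⊗ P → P` whose
multiplication and unit are coalgebra homomorphisms. -/
abbrev bialgebraOfTensorMul (m : P ⊗[F] P →ₗc[F] P) (e : F →ₗc[F] P)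
    (hassoc : ∀ a b c, m.toLinearMap (m.toLinearMap (a ⊗ₜ b) ⊗ₜ c) =
      m.toLinearMap (a ⊗ₜ m.toLinearMap (b ⊗ₜ c)))
    (hone : ∀ a, m.toLinearMap (e 1 ⊗ₜ a) = a) (hone' : ∀ a, m.toLinearMap (a ⊗ₜ e 1) = a) :
    letI := ringOfTensorMul m.toLinearMap (e 1) hassoc hone hone'
    Bialgebra F P :=
  letI := ringOfTensorMul m.toLinearMap (e 1) hassoc hone hone'
  letI := algebraOfTensorMul m.toLinearMap (e 1) hassoc hone hone'
  Bialgebra.mk' F P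
    (LinearMap.congr_fun e.counit_comp 1)
    (fun {a b} => (LinearMap.congr_fun m.counit_comp (a ⊗ₜ b)).trans (by simp [mul_comm]))
    ((LinearMap.congr_fun e.map_comp_comul 1).symm)
    (fun {a b} => by
      have h : ∀ z z' : P ⊗[F] P, TensorProduct.map m.toLinearMap m.toLinearMap
          (TensorProduct.tensorTensorTensorComm F P P P P (z ⊗ₜ z')) = z * z' := by
        intro z z'
        induction z with
        | zero => simp
        | add x y hx hy => simp only [TensorProduct.add_tmul, map_add, add_mul, hx, hy]
        | tmul m n =>
          induction z' with
          | zero => simp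
          | add x y hx hy => simp only [TensorProduct.tmul_add, map_add, mul_add, hx, hy]
          | tmul m' n' =>
            rw [TensorProduct.tensorTensorTensorComm_tmul, TensorProduct.map_tmul]
            exact (Algebra.TensorProduct.tmul_mul_tmul _ _ _ _).symm
      rw [← h]
      exact (LinearMap.congr_fun m.map_comp_comul (a ⊗ₜ b)).symm)

/-- Terminality turns the composite measuring by `P ⊗ P` and the identity measuring by `F` into
coalgebra maps `m` and `e`. The ring laws compare coalgebra maps into `P` inducing the same
measuring, which coincide by `hom_ext`. -/
theorem IsUniversalMeasuring.exists_isUniversalActing [FiniteDimensional F A]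
    {𝒜 : OmegaAlgebra F s t A} {V : Subalgebra F (Module.End F A)} {ψ : P →ₗ[F] A →ₗ[F] A}
    (h : IsUniversalMeasuring 𝒜 𝒜 (Subalgebra.toSubmodule V) ψ) :
    ∃ (B : Type u) (_ : Ring B) (_ : Bialgebra F B) (ψ : B →ₗ[F] A →ₗ[F] A),
      IsUniversalActing 𝒜 V ψ := by
  have hψV : ∀ p, ψ p ∈ V := fun p => h.cosupp_le ⟨p, rfl⟩
  have hmV : LinearMap.range (compMeas ψ ψ) ≤ Subalgebra.toSubmodule V := by
    rintro _ ⟨z, rfl⟩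
    induction z with
    | zero => rw [map_zero]; exact zero_mem _
    | add x y hx hy => rw [map_add]; exact add_mem hx hy
    | tmul p p' => rw [compMeas_tmul]; exact V.mul_mem (hψV p) (hψV p')
  have heV : LinearMap.range (LinearMap.toSpanSingleton F (A →ₗ[F] A) LinearMap.id) ≤
      Subalgebra.toSubmodule V := by
    rintro _ ⟨c, rfl⟩
    exact V.smul_mem V.one_mem c
  obtain ⟨m, hm, -⟩ := h.terminal _ (h.isMeasuring.compMeas h.isMeasuring) hmV
  obtain ⟨e, he, -⟩ := h.terminal _ isMeasuring_id heV
  replace hm : ∀ p p', ψ (m (p ⊗ₜ p')) = ψ p ∘ₗ ψ p' := fun p p' => by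
    rw [← compMeas_tmul, ← hm]; rfl
  replace he : ψ (e 1) = LinearMap.id := by
    have := LinearMap.congr_fun he 1
    rw [LinearMap.toSpanSingleton_apply, one_smul] at this
    exact this
  have hassoc : ∀ a b c, m (m (a ⊗ₜ b) ⊗ₜ c) = m (a ⊗ₜ m (b ⊗ₜ c)) := by
    have : m.comp (Coalgebra.TensorProduct.map m (CoalgHom.id F P)) =
        (m.comp (Coalgebra.TensorProduct.map (CoalgHom.id F P) m)).comp
          (Coalgebra.TensorProduct.assoc F F P P P).toCoalgHom := by
      refine h.hom_ext (TensorProduct.ext_threefold fun a b c => ?_)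
      change ψ (m (m (a ⊗ₜ b) ⊗ₜ c)) = ψ (m (a ⊗ₜ m (b ⊗ₜ c)))
      rw [hm, hm, hm, hm, LinearMap.comp_assoc]
    intro a b c
    exact DFunLike.congr_fun this ((a ⊗ₜ b) ⊗ₜ c)
  have hone : ∀ a, m (e 1 ⊗ₜ a) = a := by
    have : m.comp (Coalgebra.TensorProduct.map e (CoalgHom.id F P)) =
        (Coalgebra.TensorProduct.lid F P).toCoalgHom := by
      refine h.hom_ext (TensorProduct.ext' fun c a => ?_)
      change ψ (m (e c ⊗ₜ a)) = ψ (c • a)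
      -- Writing `c` as `c • 1` lets linearity reduce `ψ (e c)` to `ψ (e 1) = id`.
      rw [hm, ← mul_one c, ← smul_eq_mul, map_smul, map_smul, he, smul_eq_mul, mul_one, map_smul]
      rfl
    intro a
    simpa using DFunLike.congr_fun this (1 ⊗ₜ a)
  have hone' : ∀ a, m (a ⊗ₜ e 1) = a := by
    have : m.comp (Coalgebra.TensorProduct.map (CoalgHom.id F P) e) =
        (Coalgebra.TensorProduct.rid F F P).toCoalgHom := by
      refine h.hom_ext (TensorProduct.ext' fun a c => ?_)
      change ψ (m (a ⊗ₜ e c)) = ψ (c • a)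
      rw [hm, ← mul_one c, ← smul_eq_mul, map_smul, map_smul, he, smul_eq_mul, mul_one, map_smul]
      ext x
      simp
    intro a
    simpa using DFunLike.congr_fun this (a ⊗ₜ 1)
  let _ : Ring P := ringOfTensorMul m.toLinearMap (e 1) hassoc hone hone'
  let _ : Bialgebra F P := bialgebraOfTensorMul m e hassoc hone hone'
  exact ⟨P, _, _, ψ, h, fun a => LinearMap.congr_fun he a,
    fun b b' a => LinearMap.congr_fun (hm b b') a, h.isMeasuring⟩

theorem exists_isUniversalActing [FiniteDimensional F A] (𝒜 : OmegaAlgebra F s t A)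
    (V : Subalgebra F (Module.End F A)) :
    ∃ (B : Type u) (_ : Ring B) (_ : Bialgebra F B) (ψ : B →ₗ[F] A →ₗ[F] A),
      IsUniversalActing 𝒜 V ψ := by
  obtain ⟨P, _, _, _, ψ, h⟩ := exists_isUniversalMeasuring 𝒜 𝒜 (Subalgebra.toSubmodule V)
  exact h.exists_isUniversalActing

end Acting

/-! ### Transposition between `A*` and `A` -/

section Duality

variable {F : Type*} [Field F] {A : Type*} [AddCommGroup A] [Module F A] [FiniteDimensional F A]

variable (F A) in
/-- The transposition `End(A*) ≃ End(A)`. -/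
def transposeEquiv : (Module.Dual F A →ₗ[F] Module.Dual F A) ≃ₗ[F] (A →ₗ[F] A) where
  toFun f := transposeEnd f
  invFun g := g.dualMap
  map_add' f g := transposeEnd_unique fun α a => by simp [apply_transposeEnd]
  map_smul' c f := transposeEnd_unique fun α a => by simp [apply_transposeEnd]
  left_inv f := by ext α a; exact apply_transposeEnd f α a
  right_inv g := transposeEnd_unique fun α a => rfl

@[simp]
lemma apply_transposeEquiv (f : Module.Dual F A →ₗ[F] Module.Dual F A) (α : Module.Dual F A)
    (a : A) : α (transposeEquiv F A f a) = f α a :=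
  apply_transposeEnd f α a

/-- This reversal is the only source of `op` and `cop`. -/
lemma transposeEquiv_comp (f g : Module.Dual F A →ₗ[F] Module.Dual F A) :
    transposeEquiv F A (f ∘ₗ g) = transposeEquiv F A g ∘ₗ transposeEquiv F A f :=
  transposeEnd_unique fun α a => by simp

lemma transposeEquiv_id : transposeEquiv F A LinearMap.id = LinearMap.id :=
  transposeEnd_unique fun _ _ => rfl

lemma map_transposeEquiv_toSubmodule (V : Subalgebra F (Module.End F (Module.Dual F A))) :
    (Subalgebra.toSubmodule V).map (transposeEquiv F A).toLinearMap =
      Subalgebra.toSubmodule (sharp V) :=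
  SetLike.coe_injective rfl

lemma transposeEquiv_mem_sharp {V : Subalgebra F (Module.End F (Module.Dual F A))}
    {f : Module.Dual F A →ₗ[F] Module.Dual F A} :
    transposeEquiv F A f ∈ Subalgebra.toSubmodule (sharp V) ↔ f ∈ Subalgebra.toSubmodule V := by
  rw [← map_transposeEquiv_toSubmodule]
  exact (transposeEquiv F A).injective.mem_set_image

/-- Tensors in `(A*)^{⊗ n}` as functionals on `A^{⊗ n}`. -/
def dualPower (F A : Type*) [Field F] [AddCommGroup A] [Module F A] [FiniteDimensional F A]
    (n : ℕ) : (⨂[F]^n (Module.Dual F A)) ≃ₗ[F] Module.Dual F (⨂[F]^n A) :=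
  PiTensorProduct.dualDistribEquiv (R := F) (M := fun _ : Fin n => A)

lemma dualPower_tprod_tprod {n : ℕ} (y : Fin n → Module.Dual F A) (x : Fin n → A) :
    dualPower F A n (PiTensorProduct.tprod F y) (PiTensorProduct.tprod F x) = ∏ i, y i (x i) :=
  PiTensorProduct.dualDistrib_apply y x

lemma dualPower_op {Ω : Type*} {s t : Ω → ℕ} (𝒜 : OmegaAlgebra F s t A) (ω : Ω)
    (y : ⨂[F]^(t ω) (Module.Dual F A)) (x : ⨂[F]^(s ω) A) :
    dualPower F A (s ω) (𝒜.dual.op ω y) x = dualPower F A (t ω) y (𝒜.op ω x) := by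
  have h : dualPower F A (s ω) (𝒜.dual.op ω y) = dualPower F A (t ω) y ∘ₗ 𝒜.op ω :=
    (dualPower F A (s ω)).apply_symm_apply _
  rw [h, LinearMap.comp_apply]

lemma dualPower_piTensorHomMap {P : Type*} [AddCommGroup P] [Module F P] {n : ℕ}
    (ψ : P →ₗ[F] Module.Dual F A →ₗ[F] Module.Dual F A)
    (z : ⨂[F]^n P) (y : ⨂[F]^n (Module.Dual F A)) (x : ⨂[F]^n A) :
    dualPower F A n (PiTensorProduct.piTensorHomMap (PiTensorProduct.map (fun _ => ψ) z) y) x =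
      dualPower F A n y (PiTensorProduct.piTensorHomMap (PiTensorProduct.map
        (fun _ => (transposeEquiv F A).toLinearMap ∘ₗ ψ) z) x) := by
  induction z using PiTensorProduct.induction_on with
  | add z z' hz hz' => simp only [map_add, LinearMap.add_apply, hz, hz']
  | smul_tprod c z =>
    induction y using PiTensorProduct.induction_on with
    | add y y' hy hy' => simp only [map_add, LinearMap.add_apply, hy, hy']
    | smul_tprod d y =>
      induction x using PiTensorProduct.induction_on with
      | add x x' hx hx' => simp only [map_add, hx, hx']
      | smul_tprod e x =>
        simp only [map_smul, LinearMap.smul_apply, PiTensorProduct.map_tprod,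
          PiTensorProduct.piTensorHomMap_tprod_tprod, dualPower_tprod_tprod]
        simp [mul_left_comm c d]

lemma dualPower_map {n : ℕ} (f : Fin n → Module.Dual F A →ₗ[F] Module.Dual F A)
    (y : ⨂[F]^n (Module.Dual F A)) (x : ⨂[F]^n A) :
    dualPower F A n (PiTensorProduct.map f y) x =
      dualPower F A n y (PiTensorProduct.map (fun i => transposeEquiv F A (f i)) x) := by
  induction y using PiTensorProduct.induction_on with
  | add y y' hy hy' => simp only [map_add, LinearMap.add_apply, hy, hy']
  | smul_tprod d y =>
    induction x using PiTensorProduct.induction_on with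
    | add x x' hx hx' => simp only [map_add, hx, hx']
    | smul_tprod e x =>
      simp only [map_smul, LinearMap.smul_apply, PiTensorProduct.map_tprod, dualPower_tprod_tprod]
      simp

lemma dualPower_ext {n : ℕ} {y y' : ⨂[F]^n (Module.Dual F A)}
    (h : ∀ x, dualPower F A n y x = dualPower F A n y' x) : y = y' :=
  (dualPower F A n).injective (LinearMap.ext h)

lemma dualPower_separating {n : ℕ} {x x' : ⨂[F]^n A}
    (h : ∀ y, dualPower F A n y x = dualPower F A n y x') : x = x' :=
  eq_of_forall_dual_eq (F := F) fun α => by simpa using h ((dualPower F A n).symm α)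

/-- Each tensor factor is transposed in place and the iterated comultiplication of `p` is untouched,
so the coalgebra `P` need not be replaced by its co-opposite. -/
lemma dualPower_measPow {P : Type*} [AddCommGroup P] [Module F P] [Coalgebra F P] {n : ℕ}
    (ψ : P →ₗ[F] Module.Dual F A →ₗ[F] Module.Dual F A) (p : P)
    (y : ⨂[F]^n (Module.Dual F A)) (x : ⨂[F]^n A) :
    dualPower F A n (measPow ψ n p y) x =
      dualPower F A n y (measPow ((transposeEquiv F A).toLinearMap ∘ₗ ψ) n p x) :=
  dualPower_piTensorHomMap ψ _ y x

variable {Ω : Type*} {s t : Ω → ℕ} {𝒜 : OmegaAlgebra F s t A}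

/-- Paired with `x` and `y`, the measuring identity for `A*` is the one for `A` with its two sides
interchanged. -/
lemma isMeasuring_dual_iff {P : Type*} [AddCommGroup P] [Module F P] [Coalgebra F P]
    {ψ : P →ₗ[F] Module.Dual F A →ₗ[F] Module.Dual F A} :
    IsMeasuring 𝒜.dual 𝒜.dual ψ ↔ IsMeasuring 𝒜 𝒜 ((transposeEquiv F A).toLinearMap ∘ₗ ψ) := by
  constructor
  · intro h ω p x
    refine dualPower_separating fun y => ?_
    rw [← dualPower_measPow, ← dualPower_op, ← h ω p y, dualPower_measPow, dualPower_op]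
  · intro h ω p y
    refine dualPower_ext fun x => ?_
    rw [dualPower_measPow, dualPower_op, dualPower_op, dualPower_measPow, h]

lemma isComeasuring_dual_iff {K : Type*} [Fintype K] {Q : Type*} [Ring Q] [Algebra F Q]
    {f : K → Module.Dual F A →ₗ[F] Module.Dual F A} {q : K → Q} :
    IsComeasuring 𝒜.dual 𝒜.dual (coactOf f q) ↔
      IsComeasuring 𝒜 𝒜 (coactOf (fun k => transposeEquiv F A (f k)) q) := by
  rw [isComeasuring_coactOf_iff, isComeasuring_coactOf_iff]
  -- Contracting the identity for `A*` with `x` equals contracting the one for `A` with `y`; the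
  -- products of the `q k` keep their order.
  have key : ∀ ω (y : ⨂[F]^(t ω) (Module.Dual F A)) (x : ⨂[F]^(s ω) A),
      (TensorProduct.lid F Q (((dualPower F A (s ω)).toLinearMap.flip x).rTensor Q
        (∑ k : Fin (s ω) → K, PiTensorProduct.map (fun i => f (k i)) (𝒜.dual.op ω y) ⊗ₜ[F]
          (List.ofFn (fun i => q (k i))).prod)) =
      TensorProduct.lid F Q ((dualPower F A (t ω) y).rTensor Q
        (∑ k : Fin (s ω) → K, 𝒜.op ω (PiTensorProduct.map (fun i => transposeEquiv F A (f (k i))) x)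
          ⊗ₜ[F] (List.ofFn (fun i => q (k i))).prod))) ∧
      (TensorProduct.lid F Q (((dualPower F A (s ω)).toLinearMap.flip x).rTensor Q
        (∑ k : Fin (t ω) → K, 𝒜.dual.op ω (PiTensorProduct.map (fun i => f (k i)) y) ⊗ₜ[F]
          (List.ofFn (fun i => q (k i))).prod)) =
      TensorProduct.lid F Q ((dualPower F A (t ω) y).rTensor Q
        (∑ k : Fin (t ω) → K, PiTensorProduct.map (fun i => transposeEquiv F A (f (k i))) (𝒜.op ω x)
          ⊗ₜ[F] (List.ofFn (fun i => q (k i))).prod))) := by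
    intro ω y x
    simp [dualPower_map, dualPower_op]
  constructor
  · intro h ω x
    refine tensor_ext_separating_left (f := fun y => dualPower F A (t ω) y)
      (fun _ _ => dualPower_separating) fun y => ?_
    rw [← (key ω y x).1, ← (key ω y x).2, h]
  · intro h ω y
    refine tensor_ext_separating_left (f := fun x => (dualPower F A (s ω)).toLinearMap.flip x)
      (fun y y' (hx : ∀ x, dualPower F A (s ω) y x = dualPower F A (s ω) y' x) => dualPower_ext hx)
      fun x => ?_
    rw [(key ω y x).1, (key ω y x).2, h]

end Duality

/-! ### The isomorphism of acting bialgebras -/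

section Isomorphisms

variable {F : Type u} [Field F] {Ω : Type w} {s t : Ω → ℕ}
  {A : Type u} [AddCommGroup A] [Module F A] [FiniteDimensional F A] {𝒜 : OmegaAlgebra F s t A}
  {V : Subalgebra F (Module.End F (Module.Dual F A))}

lemma range_transposeEquiv_comp_le_iff {P : Type*} [AddCommGroup P] [Module F P]
    {ψ : P →ₗ[F] Module.Dual F A →ₗ[F] Module.Dual F A} :
    LinearMap.range ((transposeEquiv F A).toLinearMap ∘ₗ ψ) ≤ Subalgebra.toSubmodule (sharp V) ↔
      LinearMap.range ψ ≤ Subalgebra.toSubmodule V := by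
  rw [LinearMap.range_le_iff_comap, LinearMap.range_le_iff_comap, Submodule.eq_top_iff',
    Submodule.eq_top_iff']
  exact forall_congr' fun p => transposeEquiv_mem_sharp

lemma IsUniversalMeasuring.transpose {P : Type u} [AddCommGroup P] [Module F P] [Coalgebra F P]
    {ψ : P →ₗ[F] Module.Dual F A →ₗ[F] Module.Dual F A}
    (h : IsUniversalMeasuring 𝒜.dual 𝒜.dual (Subalgebra.toSubmodule V) ψ) :
    IsUniversalMeasuring 𝒜 𝒜 (Subalgebra.toSubmodule (sharp V))
      ((transposeEquiv F A).toLinearMap ∘ₗ ψ) := by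
  refine ⟨isMeasuring_dual_iff.1 h.isMeasuring, range_transposeEquiv_comp_le_iff.2 h.cosupp_le,
    fun ψ' hψ' hV' => ?_⟩
  have e : (transposeEquiv F A).toLinearMap ∘ₗ ((transposeEquiv F A).symm.toLinearMap ∘ₗ ψ') = ψ' :=
    LinearMap.ext fun p => (transposeEquiv F A).apply_symm_apply (ψ' p)
  rw [← e] at hψ' hV'
  obtain ⟨φ, hφ, huniq⟩ := h.terminal _ (isMeasuring_dual_iff.2 hψ')
    (range_transposeEquiv_comp_le_iff.1 hV')
  refine ⟨φ, LinearMap.ext fun p => ?_, fun χ hχ => huniq χ (LinearMap.ext fun p => ?_)⟩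
  · have := LinearMap.congr_fun hφ p
    exact (LinearEquiv.eq_symm_apply _).1 this
  · have := LinearMap.congr_fun hχ p
    exact (LinearEquiv.eq_symm_apply _).2 this

lemma isUniversalFamily_dual_iff {K : Type*} [Fintype K] {Q : Type u} [Ring Q] [Algebra F Q]
    {f : K → Module.Dual F A →ₗ[F] Module.Dual F A} {q : K → Q} :
    IsUniversalFamily 𝒜.dual 𝒜.dual f q ↔
      IsUniversalFamily 𝒜 𝒜 (fun k => transposeEquiv F A (f k)) q := by
  constructor
  · exact fun h => ⟨isComeasuring_dual_iff.1 h.isComeasuring,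
      fun q' hq' => h.initial q' (isComeasuring_dual_iff.2 hq')⟩
  · exact fun h => ⟨isComeasuring_dual_iff.2 h.isComeasuring,
      fun q' hq' => h.initial q' (isComeasuring_dual_iff.1 hq')⟩

/-- After transposition `B₁` and `B₂` are universal for the same measurings, which gives a coalgebra
isomorphism `φ`; it is antimultiplicative because transposition reverses composition. -/
theorem nonempty_bialgEquiv_mulOpposite {B₁ B₂ : Type u} [Ring B₁] [Bialgebra F B₁] [Ring B₂]
    [Bialgebra F B₂] {ψ₁ : B₁ →ₗ[F] Module.Dual F A →ₗ[F] Module.Dual F A}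
    {ψ₂ : B₂ →ₗ[F] A →ₗ[F] A} (h₁ : IsUniversalActing 𝒜.dual V ψ₁)
    (h₂ : IsUniversalActing 𝒜 (sharp V) ψ₂) : Nonempty (B₁ ≃ₐc[F] B₂ᵐᵒᵖ) := by
  have u₁ := h₁.isUniversalMeasuring.transpose
  have u₂ := h₂.isUniversalMeasuring
  obtain ⟨φ, hφ, -⟩ := u₂.terminal _ u₁.isMeasuring u₁.cosupp_le
  obtain ⟨χ, hχ, -⟩ := u₁.terminal _ u₂.isMeasuring u₂.cosupp_le
  have hχφ : χ.comp φ = CoalgHom.id F B₁ := u₁.hom_ext (LinearMap.ext fun b =>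
    (LinearMap.congr_fun hχ (φ b)).trans (LinearMap.congr_fun hφ b))
  have hφχ : φ.comp χ = CoalgHom.id F B₂ := u₂.hom_ext (LinearMap.ext fun b =>
    (LinearMap.congr_fun hφ (χ b)).trans (LinearMap.congr_fun hχ b))
  have hφ' : ∀ b, ψ₂ (φ b) = transposeEquiv F A (ψ₁ b) := LinearMap.congr_fun hφ
  have hψ₁ : ∀ b b', ψ₁ (b * b') = ψ₁ b ∘ₗ ψ₁ b' := fun b b' =>
    LinearMap.ext (h₁.isAction.mul_act b b')
  have hψ₂ : ∀ b b', ψ₂ (b * b') = ψ₂ b ∘ₗ ψ₂ b' := fun b b' =>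
    LinearMap.ext (h₂.isAction.mul_act b b')
  have hmul : ∀ b b', φ (b * b') = φ b' * φ b := by
    -- Both products are coalgebra maps on `B₁ ⊗ B₁`, the second after the flip, so terminality
    -- reduces their equality to that of the induced operators on `A`.
    have : φ.comp (Bialgebra.mulCoalgHom F B₁) =
        ((Bialgebra.mulCoalgHom F B₂).comp (Coalgebra.TensorProduct.map φ φ)).comp
          (Bialgebra.TensorProduct.comm F B₁ B₁).toCoalgEquiv.toCoalgHom := by
      refine u₂.hom_ext (TensorProduct.ext' fun b b' => ?_)
      change ψ₂ (φ (b * b')) = ψ₂ (φ b' * φ b)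
      rw [hφ', hψ₁, transposeEquiv_comp, hψ₂, hφ', hφ']
    exact fun b b' => DFunLike.congr_fun this (b ⊗ₜ b')
  have hone : φ 1 = 1 := by
    -- Since `φ (χ 1) = 1`, antimultiplicativity at `χ 1 * 1` forces `φ 1 = 1`.
    have h := hmul (χ 1) 1
    rw [mul_one, show φ (χ 1) = 1 from DFunLike.congr_fun hφχ 1, mul_one] at h
    exact h.symm
  let e : B₁ ≃ₐ[F] B₂ᵐᵒᵖ := AlgEquiv.ofLinearEquiv
    ((CoalgEquiv.ofCoalgHom φ χ hφχ hχφ).toLinearEquiv ≪≫ₗ MulOpposite.opLinearEquiv F)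
    (congrArg MulOpposite.op hone) fun b b' => congrArg MulOpposite.op (hmul b b')
  refine ⟨BialgEquiv.ofAlgEquiv e (AlgHom.toLinearMap_injective ?_)
    (AlgHom.toLinearMap_injective ?_)⟩
  · exact φ.counit_comp
  · ext b
    have := LinearMap.congr_fun φ.map_comp_comul b
    change TensorProduct.map _ _ (Coalgebra.comul (R := F) b) =
      TensorProduct.map _ _ (Coalgebra.comul (R := F) (φ.toLinearMap b))
    rw [LinearMap.comp_apply, LinearMap.comp_apply] at this
    rw [← this]
    exact LinearMap.congr_fun (TensorProduct.map_comp (MulOpposite.opLinearEquiv F).toLinearMap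
      (MulOpposite.opLinearEquiv F).toLinearMap φ.toLinearMap φ.toLinearMap)
      (Coalgebra.comul (R := F) b)

end Isomorphisms

/-! ### The isomorphism of coacting bialgebras -/

section Coacting

variable {F : Type*} [Field F] {Ω : Type*} {s t : Ω → ℕ}
  {A : Type*} [AddCommGroup A] [Module F A] {𝒜 : OmegaAlgebra F s t A}
  {K : Type*} [Fintype K]

/-- This moves an equality of coactions into `Hom(A, B)`, where transposition can be applied. -/
lemma coactOf_eq_coactOf_iff {K' : Type*} [Fintype K'] {B : Type*} [AddCommGroup B] [Module F B]
    {Q : Type*} [Ring Q] [Algebra F Q] {f : K → A →ₗ[F] B} {q : K → Q} {f' : K' → A →ₗ[F] B}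
    {q' : K' → Q} :
    coactOf f q = coactOf f' q' ↔
      ∀ α : Module.Dual F Q, ∑ k, α (q k) • f k = ∑ k, α (q' k) • f' k := by
  simp only [← coactToHom_coactOf]
  refine ⟨fun h α => by rw [h], fun h => LinearMap.ext fun a => ?_⟩
  exact tensor_ext_separating_right (f := fun α : Module.Dual F Q => α)
    (fun _ _ => eq_of_forall_dual_eq) fun α => LinearMap.congr_fun (h α) a

lemma IsCoaction.sum_counit_smul {B : Type*} [Ring B] [Bialgebra F B]
    {f : K → A →ₗ[F] A} {q : K → B}
    (h : IsCoaction 𝒜 (coactOf f q)) :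
    ∑ k, Coalgebra.counit (R := F) (q k) • f k = LinearMap.id := by
  rw [← h.counit_coact]
  ext a
  simp

lemma IsCoaction.coactOf_comul {B : Type*} [Ring B] [Bialgebra F B] {f : K → A →ₗ[F] A} {q : K → B}
    (h : IsCoaction 𝒜 (coactOf f q)) :
    coactOf f (fun k => Coalgebra.comul (R := F) (q k)) =
      coactOf (fun p : K × K => f p.1 ∘ₗ f p.2) (fun p => q p.1 ⊗ₜ[F] q p.2) := by
  rw [← lTensor_coactOf, ← h.coassoc]
  ext a
  simp [Fintype.sum_prod_type, TensorProduct.sum_tmul]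
  exact Finset.sum_comm

end Coacting

section Isomorphisms

variable {F : Type u} [Field F] {Ω : Type w} {s t : Ω → ℕ}
  {A : Type u} [AddCommGroup A] [Module F A] {𝒜 : OmegaAlgebra F s t A}

lemma IsUniversalFamily.hom_ext {B : Type u} [AddCommGroup B] [Module F B]
    {ℬ : OmegaAlgebra F s t B} {K : Type*} [Fintype K] {f : K → A →ₗ[F] B}
    {Q : Type u} [Ring Q] [Algebra F Q] {q : K → Q} (h : IsUniversalFamily 𝒜 ℬ f q)
    {Q' : Type u} [Ring Q'] [Algebra F Q'] {φ φ' : Q →ₐ[F] Q'} (hφ : ∀ k, φ (q k) = φ' (q k)) :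
    φ = φ' :=
  (h.initial _ (isComeasuring_coactOf_map φ' h.isComeasuring)).unique hφ fun _ => rfl

lemma IsUniversalFamily.exists_algEquiv {B : Type u} [AddCommGroup B] [Module F B]
    {ℬ : OmegaAlgebra F s t B} {K : Type*} [Fintype K] {f : K → A →ₗ[F] B}
    {Q Q' : Type u} [Ring Q] [Algebra F Q] {q : K → Q} (h : IsUniversalFamily 𝒜 ℬ f q)
    [Ring Q'] [Algebra F Q'] {q' : K → Q'} (h' : IsUniversalFamily 𝒜 ℬ f q') :
    ∃ φ : Q ≃ₐ[F] Q', ∀ k, φ (q k) = q' k := by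
  obtain ⟨φ, hφ, -⟩ := h.initial _ h'.isComeasuring
  obtain ⟨χ, hχ, -⟩ := h'.initial _ h.isComeasuring
  exact ⟨AlgEquiv.ofAlgHom φ χ (h'.hom_ext fun k => by simp [hφ, hχ])
    (h.hom_ext fun k => by simp [hφ, hχ]), hφ⟩

variable [FiniteDimensional F A] {V : Subalgebra F (Module.End F (Module.Dual F A))}

lemma exists_basis_toSubmodule {A : Type u} [AddCommGroup A] [Module F A] [FiniteDimensional F A]
    (V : Subalgebra F (Module.End F A)) :
    ∃ n, Nonempty (Module.Basis (Fin n) F (Subalgebra.toSubmodule V)) :=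
  ⟨_, ⟨Module.finBasis F (Subalgebra.toSubmodule V)⟩⟩

/-- Coassociativity describes `Δ(qₖ)` through the coefficients `qᵢ ⊗ qⱼ` of `fᵢ ∘ fⱼ`. The transpose
of `fᵢ ∘ fⱼ` composes the transposes in the opposite order, which flips the tensor; independence of
`f` then compares coefficients. -/
lemma comul_eq_comm_of_isCoaction {K : Type*} [Fintype K] {B₁ B₂ : Type u} [Ring B₁]
    [Bialgebra F B₁] [Ring B₂] [Bialgebra F B₂] {f : K → Module.Dual F A →ₗ[F] Module.Dual F A}
    (hf : LinearIndependent F f) {q₁ : K → B₁} {q₂ : K → B₂}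
    (c₁ : IsCoaction 𝒜.dual (coactOf f q₁))
    (c₂ : IsCoaction 𝒜 (coactOf (fun k => transposeEquiv F A (f k)) q₂))
    {φ : B₁ →ₗ[F] B₂} (hφ : ∀ k, φ (q₁ k) = q₂ k) (k : K) :
    TensorProduct.map φ φ (Coalgebra.comul (R := F) (q₁ k)) =
      TensorProduct.comm F B₂ B₂ (Coalgebra.comul (R := F) (q₂ k)) := by
  have e₁ := c₁.coactOf_comul
  have e₂ := coactOf_eq_coactOf_iff.1 c₂.coactOf_comul
  refine congrFun (coactOf_injective hf
    (q := fun k => TensorProduct.map φ φ (Coalgebra.comul (R := F) (q₁ k)))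
    (q' := fun k => TensorProduct.comm F B₂ B₂ (Coalgebra.comul (R := F) (q₂ k))) ?_) k
  have e₃ : coactOf f (fun k => TensorProduct.map φ φ (Coalgebra.comul (R := F) (q₁ k))) =
      coactOf (fun p : K × K => f p.1 ∘ₗ f p.2) (fun p => q₂ p.1 ⊗ₜ[F] q₂ p.2) := by
    rw [← lTensor_coactOf, e₁, lTensor_coactOf]
    simp only [TensorProduct.map_tmul, hφ]
  rw [e₃]
  refine coactOf_eq_coactOf_iff.2 fun α => (transposeEquiv F A).injective ?_
  -- The flip is absorbed into the functional and undone by exchanging the two summation indices.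
  have := e₂ (α ∘ₗ (TensorProduct.comm F B₂ B₂).toLinearMap)
  simp only [LinearMap.comp_apply, LinearEquiv.coe_coe, TensorProduct.comm_tmul] at this
  rw [map_sum, map_sum]
  simp only [map_smul, transposeEquiv_comp]
  rw [this]
  exact Fintype.sum_equiv (Equiv.prodComm K K) _ _ fun _ => rfl

lemma counit_eq_of_isCoaction {K : Type*} [Fintype K] {B₁ B₂ : Type u} [Ring B₁] [Bialgebra F B₁]
    [Ring B₂] [Bialgebra F B₂] {f : K → Module.Dual F A →ₗ[F] Module.Dual F A}
    (hf : LinearIndependent F f) {q₁ : K → B₁} {q₂ : K → B₂}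
    (c₁ : IsCoaction 𝒜.dual (coactOf f q₁))
    (c₂ : IsCoaction 𝒜 (coactOf (fun k => transposeEquiv F A (f k)) q₂)) (k : K) :
    Coalgebra.counit (R := F) (q₂ k) = Coalgebra.counit (R := F) (q₁ k) := by
  refine coeff_eq_of_sum_smul_eq hf (c := fun k => Coalgebra.counit (R := F) (q₂ k))
    (d := fun k => Coalgebra.counit (R := F) (q₁ k)) ?_ k
  refine (transposeEquiv F A).injective ?_
  rw [c₁.sum_counit_smul, transposeEquiv_id, ← c₂.sum_counit_smul, map_sum]
  simp only [map_smul]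

lemma nonempty_bialgEquiv_of_isUniversalFamily {K : Type*} [Fintype K] {B₁ B₂ : Type u} [Ring B₁]
    [Bialgebra F B₁] [Ring B₂] [Bialgebra F B₂]
    {f : K → Module.Dual F A →ₗ[F] Module.Dual F A}
    (hf : LinearIndependent F f) {q₁ : K → B₁} {q₂ : K → B₂}
    (u₁ : IsUniversalFamily 𝒜.dual 𝒜.dual f q₁)
    (u₂ : IsUniversalFamily 𝒜 𝒜 (fun k => transposeEquiv F A (f k)) q₂)
    (c₁ : IsCoaction 𝒜.dual (coactOf f q₁))
    (c₂ : IsCoaction 𝒜 (coactOf (fun k => transposeEquiv F A (f k)) q₂)) :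
    Nonempty (B₁ ≃ₐc[F] CoOpposite B₂) := by
  obtain ⟨φ, hφ⟩ := u₁.exists_algEquiv (isUniversalFamily_dual_iff.2 u₂)
  -- As an algebra `CoOpposite B₂` is `B₂` by definition.
  let e : B₁ ≃ₐ[F] CoOpposite B₂ := φ
  refine ⟨BialgEquiv.ofAlgEquiv e (u₁.hom_ext fun k => ?_) (u₁.hom_ext fun k => ?_)⟩
  · change Coalgebra.counit (R := F) (φ (q₁ k)) = Coalgebra.counit (R := F) (q₁ k)
    rw [hφ, counit_eq_of_isCoaction hf c₁ c₂]
  · change TensorProduct.map φ.toLinearMap φ.toLinearMap (Coalgebra.comul (R := F) (q₁ k)) =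
      TensorProduct.comm F B₂ B₂ (Coalgebra.comul (R := F) (φ (q₁ k)))
    rw [hφ, comul_eq_comm_of_isCoaction hf c₁ c₂ hφ]

theorem nonempty_bialgEquiv_coOpposite {B₁ B₂ : Type u} [Ring B₁] [Bialgebra F B₁] [Ring B₂]
    [Bialgebra F B₂] {ρ₁ : Module.Dual F A →ₗ[F] Module.Dual F A ⊗[F] B₁}
    {ρ₂ : A →ₗ[F] A ⊗[F] B₂} (h₁ : IsUniversalCoacting 𝒜.dual V ρ₁)
    (h₂ : IsUniversalCoacting 𝒜 (sharp V) ρ₂) : Nonempty (B₁ ≃ₐc[F] CoOpposite B₂) := by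
  obtain ⟨n, ⟨v⟩⟩ := exists_basis_toSubmodule V
  -- With the transposed basis of `V^#`, both coactions are indexed alike and have operators
  -- transposed to each other.
  let v' : Module.Basis _ F (Subalgebra.toSubmodule (sharp V)) :=
    v.map ((transposeEquiv F A).submoduleMap (Subalgebra.toSubmodule V) ≪≫ₗ
      LinearEquiv.ofEq _ _ (map_transposeEquiv_toSubmodule V))
  obtain ⟨q₁, rfl⟩ := exists_eq_coactOf v h₁.isUniversalComeasuring.cosupp_le
  obtain ⟨q₂, rfl⟩ := exists_eq_coactOf v' h₂.isUniversalComeasuring.cosupp_le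
  exact nonempty_bialgEquiv_of_isUniversalFamily
    (linearIndependent_coe_basis v)
    ((isUniversalComeasuring_iff v q₁).1 h₁.isUniversalComeasuring)
    ((isUniversalComeasuring_iff v' q₂).1 h₂.isUniversalComeasuring)
    h₁.isCoaction h₂.isCoaction

end Isomorphisms

end

/-- The isomorphisms are asserted for all representatives, since the universal properties fix the
bialgebras only up to isomorphism. -/
theorem mainTheorem11 {F : Type u} [Field F] {Ω : Type w} (s t : Ω → ℕ)
    {A : Type u} [AddCommGroup A] [Module F A] [FiniteDimensional F A]
    (𝒜 : OmegaAlgebra F s t A)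
    (V : Subalgebra F (Module.End F (Module.Dual F A))) :
    -- the two universal acting bialgebras exist and are isomorphic up to `op`
    ((∃ (B : Type u) (_ : Ring B) (_ : Bialgebra F B)
        (ψ : B →ₗ[F] Module.Dual F A →ₗ[F] Module.Dual F A), IsUniversalActing 𝒜.dual V ψ) ∧
      (∃ (B : Type u) (_ : Ring B) (_ : Bialgebra F B)
        (ψ : B →ₗ[F] A →ₗ[F] A), IsUniversalActing 𝒜 (sharp V) ψ) ∧
      ∀ (B₁ B₂ : Type u) [Ring B₁] [Bialgebra F B₁] [Ring B₂] [Bialgebra F B₂]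
        (ψ₁ : B₁ →ₗ[F] Module.Dual F A →ₗ[F] Module.Dual F A) (ψ₂ : B₂ →ₗ[F] A →ₗ[F] A),
        IsUniversalActing 𝒜.dual V ψ₁ → IsUniversalActing 𝒜 (sharp V) ψ₂ →
          Nonempty (B₁ ≃ₐc[F] B₂ᵐᵒᵖ)) ∧
    -- the two universal coacting bialgebras exist and are isomorphic up to `cop`
    ((∃ (B : Type u) (_ : Ring B) (_ : Bialgebra F B)
        (ρ : Module.Dual F A →ₗ[F] Module.Dual F A ⊗[F] B), IsUniversalCoacting 𝒜.dual V ρ) ∧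
      (∃ (B : Type u) (_ : Ring B) (_ : Bialgebra F B)
        (ρ : A →ₗ[F] A ⊗[F] B), IsUniversalCoacting 𝒜 (sharp V) ρ) ∧
      ∀ (B₁ B₂ : Type u) [Ring B₁] [Bialgebra F B₁] [Ring B₂] [Bialgebra F B₂]
        (ρ₁ : Module.Dual F A →ₗ[F] Module.Dual F A ⊗[F] B₁) (ρ₂ : A →ₗ[F] A ⊗[F] B₂),
        IsUniversalCoacting 𝒜.dual V ρ₁ → IsUniversalCoacting 𝒜 (sharp V) ρ₂ →
          Nonempty (B₁ ≃ₐc[F] CoOpposite B₂)) :=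
  ⟨⟨exists_isUniversalActing _ _, exists_isUniversalActing _ _,
    fun _ _ _ _ _ _ _ _ h₁ h₂ => nonempty_bialgEquiv_mulOpposite h₁ h₂⟩,
   ⟨exists_isUniversalCoacting _ _, exists_isUniversalCoacting _ _,
    fun _ _ _ _ _ _ _ _ h₁ h₂ => nonempty_bialgEquiv_coOpposite h₁ h₂⟩⟩
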